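/- For finite graphs $G,H$ and an integer $q$ with $2\le q\le |E(H)|$, an $(H,q)$-coloring of $G$ is an edge-coloring of $G$ (not necessarily proper) such that every copy of $H$ in $G$ (every not necessarily induced subgraph isomorphic to $H$) receives at least $q$ distinct colors, and $r(G,H,q)$ denotes the minimum number of colors that are needed for $G$ to have an $(H,q)$-coloring. $K_{m,m}$ is the complete bipartite graph with $m$ vertices in each part. Theorem. Let $t\ge 2$ and $r\ge 3$ be integers, let $s\ge 2r-1$ be an odd integer, and let $p=r\left(\frac{(s-1)t}{2}+1\right)$. Then $$r\left(K_{n,n},K_{p,p},p^2-(r-1)st+2\right)=\Omega\left(n^{\frac{r}{r-1}\left(1-\frac1s\right)}\right)\qquad (n\to\infty),$$ that is, there are a constant $c>0$ and an $n_0$, depending only on $r,s,t$, such that for all integers $n\ge n_0$ the left-hand side is at least $c\,n^{\frac{r}{r-1}\left(1-\frac1s\right)}$. -/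

import Mathlib

open Filter Asymptotics

namespace ErdosGyarfas

/-- An edge-coloring `C` of `G` is an `(H, q)`-coloring if every copy of `H` in `G` receives at
least `q` distinct colors. -/
def IsHQColoring {V W K : Type*} {G : SimpleGraph V} (H : SimpleGraph W) (q : ℕ)
    (C : G.EdgeLabeling K) : Prop :=
  ∀ f : H.Copy G, (q : ℕ∞) ≤ (Set.range fun e : H.edgeSet => C (f.mapEdgeSet e)).encard

/-- `r(G, H, q)`: the minimum number of colors that are needed for `G` to have an
`(H, q)`-coloring. -/
noncomputable def colorNumber {V W : Type*} (G : SimpleGraph V) (H : SimpleGraph W) (q : ℕ) : ℕ :=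
  sInf {k : ℕ | ∃ C : G.EdgeLabeling (Fin k), IsHQColoring H q C}

/-- For finite `G` and `q ≤ |E(H)|` an `(H, q)`-coloring exists (color all edges differently), so
the minimum above is attained. -/
theorem colorNumber_spec {V W : Type*} [Finite V] (G : SimpleGraph V) (H : SimpleGraph W) (q : ℕ)
    (hq : (q : ℕ∞) ≤ H.edgeSet.encard) :
    ∃ C : G.EdgeLabeling (Fin (colorNumber G H q)), IsHQColoring H q C := by
  have h : {k : ℕ | ∃ C : G.EdgeLabeling (Fin k), IsHQColoring H q C}.Nonempty := by
    obtain ⟨k, ⟨e⟩⟩ := Finite.exists_equiv_fin G.edgeSet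
    refine ⟨k, (fun x => e x : G.edgeSet → Fin k), fun f => hq.trans ?_⟩
    have hi : Function.Injective fun x : H.edgeSet => e (f.mapEdgeSet x) :=
      e.injective.comp f.mapEdgeSet.injective
    have h2 := hi.encard_range
    rw [ENat.card_coe_set_eq] at h2
    exact h2.ge
  exact Nat.sInf_mem h

end ErdosGyarfas

/-!
Let `χ` be a coloring of `K_{n,n}` with `k` colors in which every `K_{p,p}` has at least `q`
colors, that is, at most `p ^ 2 - q = (r - 1) * s * t - 2` repetitions. The lower bound on `k`
comes from the color energy graph: its vertices are the `r`-tuples of vertices in one part, and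
`x`, `y` are adjacent if the `r` edges `(x i, y i)` have the same color. It has `2 * n ^ r`
vertices and, by convexity, at least about `n ^ (2 * r) / k ^ (r - 1)` edges. If `k` were much
smaller than claimed, this would be much more than `(n ^ r) ^ (1 + 1 / s)`, the order of the
Faudree–Simonovits bound for the theta graph formed by `t` paths of length `s`. The coordinates of such
a theta graph, if they are all different, span `r * ((s - 1) * t / 2 + 1) = p` vertices in each
part, since `s` is odd, and `r * s * t` edges of at most `s * t` colors. These are too many
repetitions (`FewRepeats.not_isTheta`).

The theta graph has to be found without coincidences between coordinates, called conflicts. The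
coloring is therefore cleaned first. If a monochromatic star with `p` leaves had two leaves on
which `p` vertices repeat a color, it would give `2 * p - 2` repetitions, which is too many since
`s ≥ r`; hence large monochromatic stars contain few edges, and each color class can be replaced
by a matching such that a positive proportion of the edges is kept
(`FewRepeats.exists_matchings`). Then a neighbour of a tuple is determined by one of its vertices,
so at most `r ^ 2` neighbours of any tuple conflict with a given tuple (`card_conflict_le`).

It remains to find a theta graph without conflicts in a dense graph with this property
(`exists_isTheta`). After passing to a subgraph of minimum degree `δ`, walks are weighted by the
normalized adjacency matrix `F`, with entries `1 / √(d u * d v)`. Let `h j` be the squared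
Frobenius norm of `F ^ j`, the total weight of the closed walks of length `2 * j`. By the
Cauchy–Schwarz inequality, the closed walks of length `2 * s` with a conflict at two given
positions weigh at most `√(K / δ * h (s - 1) * h s)` (`closedSum_sq_le`). The sequence `h` is
log-convex, `h 0` is the number `N` of vertices, and `h s ≥ 1` because `F` has the eigenvalue `1`;
hence `h (s - 1) ≤ N ^ (1 / s) * h s`, and for `δ` large compared with `N ^ (1 / s)` only a small
proportion of the closed walks have a conflict. A closed walk consists of two walks of length `s`
with common ends, so for some pair of ends two random walks between them are unlikely to conflict,
and `t` pairwise compatible ones exist.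
-/

/-! ### Powers of a symmetric nonnegative matrix and closed walks with a conflict -/

namespace ConflictFree

open Matrix

variable {V : Type*} [Fintype V] [DecidableEq V]

/-- The squared Frobenius norm of `F ^ j`. -/
noncomputable def powNormSq (F : Matrix V V ℝ) (j : ℕ) : ℝ := ∑ a, ∑ b, (F ^ j) a b ^ 2

theorem powNormSq_nonneg (F : Matrix V V ℝ) (j : ℕ) : 0 ≤ powNormSq F j :=
  Finset.sum_nonneg fun _ _ => Finset.sum_nonneg fun _ _ => sq_nonneg _

theorem powNormSq_zero (F : Matrix V V ℝ) : powNormSq F 0 = Fintype.card V := by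
  simp [powNormSq, Matrix.one_apply]

theorem pow_apply_comm {F : Matrix V V ℝ} (hF : F.IsSymm) (j : ℕ) (a b : V) :
    (F ^ j) a b = (F ^ j) b a :=
  (hF.pow j).apply b a

theorem pow_apply_nonneg {F : Matrix V V ℝ} (h0 : ∀ a b, 0 ≤ F a b) (j : ℕ) (a b : V) :
    0 ≤ (F ^ j) a b := by
  induction j generalizing a b with
  | zero => rw [pow_zero, Matrix.one_apply]; split_ifs <;> norm_num
  | succ j ih =>
    rw [pow_succ, Matrix.mul_apply]
    exact Finset.sum_nonneg fun c _ => mul_nonneg (ih a c) (h0 c b)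

theorem sum_pow_mul_pow (F : Matrix V V ℝ) (i j : ℕ) (a b : V) :
    ∑ c, (F ^ i) a c * (F ^ j) c b = (F ^ (i + j)) a b := by
  rw [pow_add, Matrix.mul_apply]

/-- For symmetric `F` the squared Frobenius norm of `F ^ j` is the trace of `F ^ (2 * j)`, and this
trace is also the Frobenius inner product of any two powers whose exponents add up to `2 * j`. -/
theorem powNormSq_eq_sum {F : Matrix V V ℝ} (hF : F.IsSymm) {i j l : ℕ} (h : i + l = 2 * j) :
    powNormSq F j = ∑ a, ∑ b, (F ^ i) a b * (F ^ l) a b := by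
  have key : ∀ i l : ℕ, ∑ a, ∑ b, (F ^ i) a b * (F ^ l) a b = ∑ a, (F ^ (i + l)) a a := by
    intro i l
    refine Finset.sum_congr rfl fun a _ => ?_
    rw [← sum_pow_mul_pow]
    exact Finset.sum_congr rfl fun b _ => by rw [pow_apply_comm hF l a b]
  rw [key, h, powNormSq, two_mul, ← key]
  simp only [sq]

theorem powNormSq_sq_le {F : Matrix V V ℝ} (hF : F.IsSymm) (j : ℕ) :
    powNormSq F (j + 1) ^ 2 ≤ powNormSq F j * powNormSq F (j + 2) := by
  rw [powNormSq_eq_sum hF (show j + (j + 2) = 2 * (j + 1) by ring)]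
  simp only [powNormSq, ← Finset.sum_product']
  exact Finset.sum_mul_sq_le_sq_mul_sq _ _ _

/-- A positive log-convex sequence satisfies `a m ^ (m + 1) ≤ a 0 * a (m + 1) ^ m`. -/
theorem pow_succ_le_of_sq_le {a : ℕ → ℝ} (hpos : ∀ j, 0 < a j)
    (h : ∀ j, a (j + 1) ^ 2 ≤ a j * a (j + 2)) (m : ℕ) :
    a m ^ (m + 1) ≤ a 0 * a (m + 1) ^ m := by
  induction m with
  | zero => simp
  | succ m ih =>
    have h1 : (a (m + 1) ^ 2) ^ (m + 1) ≤ (a m * a (m + 2)) ^ (m + 1) :=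
      pow_le_pow_left₀ (sq_nonneg _) (h m) _
    have h2 : a m ^ (m + 1) * a (m + 2) ^ (m + 1) ≤
        a 0 * a (m + 1) ^ m * a (m + 2) ^ (m + 1) :=
      mul_le_mul_of_nonneg_right ih (pow_nonneg (hpos _).le _)
    have h3 : a (m + 1) ^ m * a (m + 1) ^ (m + 1 + 1) ≤
        a (m + 1) ^ m * (a 0 * a (m + 1 + 1) ^ (m + 1)) := by
      calc a (m + 1) ^ m * a (m + 1) ^ (m + 1 + 1) = (a (m + 1) ^ 2) ^ (m + 1) := by ring
        _ ≤ _ := h1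
        _ = a m ^ (m + 1) * a (m + 2) ^ (m + 1) := mul_pow _ _ _
        _ ≤ _ := h2
        _ = _ := by ring
    exact le_of_mul_le_mul_left h3 (pow_pos (hpos _) _)

/-- The total weight of closed walks of length `2 * k` on which the vertices at positions `0` and
`d` are weighted by `φ`. -/
noncomputable def closedSum (F : Matrix V V ℝ) (φ : V → V → ℝ) (k d : ℕ) : ℝ :=
  ∑ u, ∑ v, φ u v * ((F ^ d) u v * (F ^ (2 * k - d)) v u)

/-- Cauchy–Schwarz over the position-`0` vertex `u`, its successor `y` and the vertex `z` at
distance `k` from `y`: since `u` is one of at most `K` neighbours of `y` that are in conflict with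
the vertex at position `d`, the conflicting closed walks are rare. -/
theorem closedSum_sq_le_of_le {F : Matrix V V ℝ} (hF : F.IsSymm) (h0 : ∀ a b, 0 ≤ F a b)
    {φ : V → V → ℝ} (hφ0 : ∀ u v, 0 ≤ φ u v) (hφ1 : ∀ u v, φ u v ≤ 1)
    {K τ : ℝ} (hK : ∀ y v, ∑ u, (if F u y = 0 then 0 else φ u v) ≤ K)
    (hτ : ∀ u, ∑ y, F u y ^ 2 ≤ τ) {k d : ℕ} (hd1 : 1 ≤ d) (hdk : d ≤ k) :
    closedSum F φ k d ^ 2 ≤ K * τ * powNormSq F (k - 1) * powNormSq F k := by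
  obtain ⟨e, rfl⟩ : ∃ e, d = e + 1 := ⟨d - 1, by omega⟩
  have hP := pow_apply_nonneg h0
  set g : V → V → V → ℝ := fun u y z =>
    if F u y = 0 then 0 else ∑ v, φ u v * ((F ^ e) y v * (F ^ (k - e)) v z) with hg
  have hT : closedSum F φ k (e + 1) =
      ∑ x : V × V × V, (F x.1 x.2.1 * (F ^ (k - 1)) x.2.2 x.1) * g x.1 x.2.1 x.2.2 := by
    simp only [← Finset.univ_product_univ, Finset.sum_product]
    unfold closedSum
    refine Finset.sum_congr rfl fun u _ => ?_
    have hv : ∀ v, φ u v * ((F ^ (e + 1)) u v * (F ^ (2 * k - (e + 1))) v u) =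
        ∑ y, ∑ z, (F u y * (F ^ (k - 1)) z u) *
          (φ u v * ((F ^ e) y v * (F ^ (k - e)) v z)) := by
      intro v
      rw [show 2 * k - (e + 1) = (k - e) + (k - 1) by omega, pow_succ' F e, Matrix.mul_apply,
        ← sum_pow_mul_pow F (k - e), Finset.sum_mul_sum, Finset.mul_sum]
      refine Finset.sum_congr rfl fun y _ => ?_
      rw [Finset.mul_sum]
      exact Finset.sum_congr rfl fun z _ => by ring
    simp only [hv]
    rw [Finset.sum_comm]
    refine Finset.sum_congr rfl fun y _ => ?_
    rw [Finset.sum_comm]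
    refine Finset.sum_congr rfl fun z _ => ?_
    rw [← Finset.mul_sum]
    simp only [hg]
    split_ifs with h
    · simp [h]
    · rfl
  have h1 : ∑ x : V × V × V, (F x.1 x.2.1 * (F ^ (k - 1)) x.2.2 x.1) ^ 2 ≤
      τ * powNormSq F (k - 1) := by
    simp only [← Finset.univ_product_univ, Finset.sum_product, powNormSq, Finset.mul_sum]
    refine Finset.sum_le_sum fun u _ => ?_
    rw [Finset.sum_comm]
    refine Finset.sum_le_sum fun z _ => ?_
    simp only [mul_pow, ← Finset.sum_mul]
    rw [pow_apply_comm hF _ z u]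
    exact mul_le_mul_of_nonneg_right (hτ u) (sq_nonneg _)
  have hg0 : ∀ u y z, 0 ≤ g u y z := by
    intro u y z
    simp only [hg]
    split_ifs
    · exact le_rfl
    · exact Finset.sum_nonneg fun v _ => mul_nonneg (hφ0 _ _) (mul_nonneg (hP _ _ _) (hP _ _ _))
  have hw : ∀ y z, ∑ v, (F ^ e) y v * (F ^ (k - e)) v z = (F ^ k) y z := by
    intro y z
    rw [sum_pow_mul_pow, show e + (k - e) = k by omega]
  have hg1 : ∀ u y z, g u y z ≤ (F ^ k) y z := by
    intro u y z
    simp only [hg]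
    split_ifs
    · exact hP _ _ _
    · rw [← hw]
      exact Finset.sum_le_sum fun v _ =>
        mul_le_of_le_one_left (mul_nonneg (hP _ _ _) (hP _ _ _)) (hφ1 _ _)
  have hg2 : ∀ y z, ∑ u, g u y z ≤ K * (F ^ k) y z := by
    intro y z
    have : ∀ u, g u y z = ∑ v, (if F u y = 0 then 0 else φ u v) *
        ((F ^ e) y v * (F ^ (k - e)) v z) := by
      intro u
      simp only [hg]
      split_ifs <;> simp
    simp only [this]
    rw [Finset.sum_comm, ← hw, Finset.mul_sum]
    refine Finset.sum_le_sum fun v _ => ?_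
    rw [← Finset.sum_mul]
    exact mul_le_mul_of_nonneg_right (hK y v) (mul_nonneg (hP _ _ _) (hP _ _ _))
  have h2 : ∑ x : V × V × V, g x.1 x.2.1 x.2.2 ^ 2 ≤ K * powNormSq F k := by
    simp only [← Finset.univ_product_univ, Finset.sum_product, powNormSq, Finset.mul_sum]
    rw [Finset.sum_comm]
    refine Finset.sum_le_sum fun y _ => ?_
    rw [Finset.sum_comm]
    refine Finset.sum_le_sum fun z _ => ?_
    calc ∑ u, g u y z ^ 2 ≤ ∑ u, (F ^ k) y z * g u y z := by
          refine Finset.sum_le_sum fun u _ => ?_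
          rw [sq]
          exact mul_le_mul_of_nonneg_right (hg1 u y z) (hg0 u y z)
      _ = (F ^ k) y z * ∑ u, g u y z := (Finset.mul_sum _ _ _).symm
      _ ≤ (F ^ k) y z * (K * (F ^ k) y z) := mul_le_mul_of_nonneg_left (hg2 y z) (hP _ _ _)
      _ = K * (F ^ k) y z ^ 2 := by ring
  rw [hT]
  calc _ ≤ _ := Finset.sum_mul_sq_le_sq_mul_sq _ _ _
    _ ≤ (τ * powNormSq F (k - 1)) * (K * powNormSq F k) :=
        mul_le_mul h1 h2 (Finset.sum_nonneg fun _ _ => sq_nonneg _)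
          ((Finset.sum_nonneg fun _ _ => sq_nonneg _).trans h1)
    _ = _ := by ring

theorem closedSum_sub {F : Matrix V V ℝ} {φ : V → V → ℝ} (hφ : ∀ u v, φ u v = φ v u)
    {k d : ℕ} (hd : d ≤ 2 * k) : closedSum F φ k (2 * k - d) = closedSum F φ k d := by
  unfold closedSum
  rw [Finset.sum_comm, show 2 * k - (2 * k - d) = d by omega]
  exact Finset.sum_congr rfl fun u _ => Finset.sum_congr rfl fun v _ => by rw [hφ]; ring

theorem closedSum_sq_le {F : Matrix V V ℝ} (hF : F.IsSymm) (h0 : ∀ a b, 0 ≤ F a b)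
    {φ : V → V → ℝ} (hφ0 : ∀ u v, 0 ≤ φ u v) (hφ1 : ∀ u v, φ u v ≤ 1)
    (hφ : ∀ u v, φ u v = φ v u)
    {K τ : ℝ} (hK : ∀ y v, ∑ u, (if F u y = 0 then 0 else φ u v) ≤ K)
    (hτ : ∀ u, ∑ y, F u y ^ 2 ≤ τ) {k d : ℕ} (hd1 : 1 ≤ d) (hdk : d < 2 * k) :
    closedSum F φ k d ^ 2 ≤ K * τ * powNormSq F (k - 1) * powNormSq F k := by
  rcases le_or_gt d k with h | h
  · exact closedSum_sq_le_of_le hF h0 hφ0 hφ1 hK hτ hd1 h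
  · rw [← closedSum_sub hφ hdk.le]
    exact closedSum_sq_le_of_le hF h0 hφ0 hφ1 hK hτ (by omega) (by omega)

end ConflictFree

/-! ### Weighted walks between two given ends -/

namespace ConflictFree

open Matrix

variable {V : Type*} [Fintype V] [DecidableEq V]

theorem sum_comm₂₂ {α : Type*} [Fintype α] (f : α → α → α → α → ℝ) :
    ∑ a, ∑ b, ∑ u, ∑ v, f a b u v = ∑ u, ∑ v, ∑ a, ∑ b, f a b u v := by
  rw [Finset.sum_congr rfl fun a _ => Finset.sum_comm, Finset.sum_comm]
  refine Finset.sum_congr rfl fun u _ => ?_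
  rw [Finset.sum_congr rfl fun a _ => Finset.sum_comm, Finset.sum_comm]

/-- The weight of the walk `P`: the product of the entries of `F` along its steps. -/
noncomputable def walkWeight (F : Matrix V V ℝ) {k : ℕ} (P : Fin (k + 1) → V) : ℝ :=
  ∏ i : Fin k, F (P i.castSucc) (P i.succ)

/-- The weight of the walk `P` if it leads from `a` to `b`, and `0` otherwise. -/
noncomputable def walkMass (F : Matrix V V ℝ) {k : ℕ} (a b : V) (P : Fin (k + 1) → V) : ℝ :=
  if P 0 = a ∧ P (Fin.last k) = b then walkWeight F P else 0

theorem walkMass_cons (F : Matrix V V ℝ) {k : ℕ} (a b x : V) (P : Fin (k + 1) → V) :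
    walkMass F a b (Fin.cons x P : Fin (k + 1 + 1) → V) =
      if x = a then ∑ c, F a c * walkMass F c b P else 0 := by
  have h1 : ∑ c, F a c * walkMass F c b P =
      if P (Fin.last k) = b then F a (P 0) * walkWeight F P else 0 := by
    rw [Finset.sum_eq_single (P 0)]
    · by_cases h : P (Fin.last k) = b <;> simp [walkMass, h]
    · intro c _ hc
      simp [walkMass, hc.symm]
    · simp
  rw [h1]
  have h2 : walkWeight F (Fin.cons x P : Fin (k + 1 + 1) → V) = F x (P 0) * walkWeight F P := by
    simp [walkWeight, Fin.prod_univ_succ]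
  have h3 : (Fin.cons x P : Fin (k + 1 + 1) → V) (Fin.last (k + 1)) = P (Fin.last k) := by
    rw [← Fin.succ_last, Fin.cons_succ]
  unfold walkMass
  rw [h2, h3, Fin.cons_zero]
  by_cases hx : x = a
  · subst hx; simp
  · simp [hx]

theorem sum_walkMass_cons (F : Matrix V V ℝ) {k : ℕ} (a b : V)
    (Φ : (Fin (k + 1 + 1) → V) → ℝ) :
    ∑ P, walkMass F a b P * Φ P =
      ∑ c, F a c * ∑ P : Fin (k + 1) → V, walkMass F c b P * Φ (Fin.cons a P) := by
  rw [← (Fin.consEquiv fun _ => V).sum_comp, Fintype.sum_prod_type,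
    Finset.sum_eq_single a]
  · have h : ∀ P : Fin (k + 1) → V, (Fin.consEquiv fun _ : Fin (k + 1 + 1) => V) (a, P) =
      Fin.cons a P := fun _ => rfl
    simp only [h, walkMass_cons, if_true, Finset.sum_mul, Finset.mul_sum]
    rw [Finset.sum_comm]
    exact Finset.sum_congr rfl fun _ _ => Finset.sum_congr rfl fun _ _ => by ring
  · intro x _ hx
    refine Finset.sum_eq_zero fun P _ => ?_
    change walkMass F a b (Fin.cons x P) * _ = 0
    rw [walkMass_cons, if_neg hx, zero_mul]
  · simp

theorem sum_walkMass (F : Matrix V V ℝ) (k : ℕ) (a b : V) :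
    ∑ P : Fin (k + 1) → V, walkMass F a b P = (F ^ k) a b := by
  induction k generalizing a with
  | zero =>
    rw [← (Equiv.funUnique (Fin 1) V).symm.sum_comp]
    simp [walkMass, walkWeight, Matrix.one_apply, ite_and]
  | succ k ih =>
    have := sum_walkMass_cons F (k := k) a b fun _ => 1
    simp only [mul_one] at this
    rw [this, pow_succ', Matrix.mul_apply]
    simp only [ih]

theorem sum_walkMass_apply (F : Matrix V V ℝ) (φ : V → ℝ) (k : ℕ) (i : ℕ) (hi : i < k + 1)
    (a b : V) :
    ∑ P : Fin (k + 1) → V, walkMass F a b P * φ (P ⟨i, hi⟩) =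
      ∑ u, (F ^ i) a u * φ u * (F ^ (k - i)) u b := by
  have hzero : ∀ k a, ∑ P : Fin (k + 1) → V, walkMass F a b P * φ (P 0) =
      ∑ u, (F ^ 0) a u * φ u * (F ^ k) u b := by
    intro k a
    rw [pow_zero, Finset.sum_eq_single a]
    · rw [Matrix.one_apply_eq, one_mul, ← sum_walkMass, Finset.mul_sum]
      refine Finset.sum_congr rfl fun P _ => ?_
      unfold walkMass
      by_cases h : P 0 = a
      · rw [h]; ring
      · simp [h]
    · intro u _ hu
      rw [Matrix.one_apply_ne hu.symm]; ring
    · simp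
  induction k generalizing a i with
  | zero =>
    obtain rfl : i = 0 := by omega
    exact hzero 0 a
  | succ k ih =>
    cases i with
    | zero => exact hzero (k + 1) a
    | succ i =>
      rw [sum_walkMass_cons]
      have hc : ∀ P : Fin (k + 1) → V, (Fin.cons a P : Fin (k + 1 + 1) → V) ⟨i + 1, hi⟩ =
        P ⟨i, by omega⟩ := fun P => rfl
      simp only [hc, ih i (by omega), Nat.succ_sub_succ, Finset.mul_sum, pow_succ' F i,
        Matrix.mul_apply, Finset.sum_mul]
      rw [Finset.sum_comm]
      exact Finset.sum_congr rfl fun _ _ => Finset.sum_congr rfl fun _ _ => by ring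

theorem sum_walkMass_apply₂ (F : Matrix V V ℝ) (φ : V → V → ℝ) (k : ℕ) (i j : ℕ) (hij : i < j)
    (hj : j < k + 1) (a b : V) :
    ∑ P : Fin (k + 1) → V, walkMass F a b P * φ (P ⟨i, hij.trans hj⟩) (P ⟨j, hj⟩) =
      ∑ u, ∑ v, φ u v * ((F ^ i) a u * (F ^ (j - i)) u v * (F ^ (k - j)) v b) := by
  induction k generalizing a i j with
  | zero => omega
  | succ k ih =>
    cases i with
    | zero =>
      have h := sum_walkMass_apply F (φ a) (k + 1) j hj a b
      rw [pow_zero, Finset.sum_eq_single a]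
      · simp only [Matrix.one_apply_eq, one_mul, Nat.sub_zero]
        rw [show ∑ v, φ a v * ((F ^ j) a v * (F ^ (k + 1 - j)) v b) =
          ∑ u, (F ^ j) a u * φ a u * (F ^ (k + 1 - j)) u b from
          Finset.sum_congr rfl fun _ _ => by ring, ← h]
        refine Finset.sum_congr rfl fun P _ => ?_
        change walkMass F a b P * φ (P 0) _ = _
        unfold walkMass
        by_cases h : P 0 = a
        · rw [h]
        · simp [h]
      · intro u _ hu
        simp [Matrix.one_apply_ne hu.symm]
      · simp
    | succ i =>
      obtain ⟨j, rfl⟩ : ∃ j', j = j' + 1 := ⟨j - 1, by omega⟩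
      rw [sum_walkMass_cons]
      have hc : ∀ P : Fin (k + 1) → V, ∀ l (hl : l + 1 < k + 1 + 1),
        (Fin.cons a P : Fin (k + 1 + 1) → V) ⟨l + 1, hl⟩ =
        P ⟨l, by omega⟩ := fun P l hl => rfl
      simp only [hc, ih i j (by omega) (by omega), Nat.succ_sub_succ, Finset.mul_sum,
        pow_succ' F i, Matrix.mul_apply, Finset.sum_mul]
      rw [Finset.sum_comm]
      refine Finset.sum_congr rfl fun u _ => ?_
      rw [Finset.sum_comm]
      exact Finset.sum_congr rfl fun _ _ => Finset.sum_congr rfl fun _ _ => by ring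

/-- Two walks with common ends form a closed walk; a conflict between positions `i < j` of the
first one is a conflict at distance `j - i` on it. -/
theorem sum_walkMass_within {F : Matrix V V ℝ} (hF : F.IsSymm) (φ : V → V → ℝ) {k i j : ℕ}
    (hij : i < j) (hj : j < k + 1) :
    ∑ a, ∑ b, ∑ P : Fin (k + 1) → V, ∑ Q : Fin (k + 1) → V, walkMass F a b P * walkMass F a b Q *
      φ (P ⟨i, hij.trans hj⟩) (P ⟨j, hj⟩) = closedSum F φ k (j - i) := by
  have h : ∀ a b, ∑ P : Fin (k + 1) → V, ∑ Q : Fin (k + 1) → V,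
      walkMass F a b P * walkMass F a b Q * φ (P ⟨i, hij.trans hj⟩) (P ⟨j, hj⟩) =
      ∑ u, ∑ v, φ u v * (F ^ (j - i)) u v *
        ((F ^ (k - j)) v b * ((F ^ k) b a * (F ^ i) a u)) := by
    intro a b
    calc _ = (∑ P : Fin (k + 1) → V, walkMass F a b P *
          φ (P ⟨i, hij.trans hj⟩) (P ⟨j, hj⟩)) * ∑ Q : Fin (k + 1) → V, walkMass F a b Q := by
          rw [Finset.sum_mul_sum]
          exact Finset.sum_congr rfl fun _ _ => Finset.sum_congr rfl fun _ _ => by ring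
      _ = _ := by
          rw [sum_walkMass_apply₂ F φ k i j hij hj, sum_walkMass, pow_apply_comm hF k a b]
          simp only [Finset.sum_mul]
          exact Finset.sum_congr rfl fun _ _ => Finset.sum_congr rfl fun _ _ => by ring
  simp only [h]
  have h2 : ∀ v u, ∑ a, ∑ b, (F ^ (k - j)) v b * ((F ^ k) b a * (F ^ i) a u) =
      (F ^ (2 * k - (j - i))) v u := by
    intro v u
    rw [Finset.sum_comm]
    simp only [← Finset.mul_sum, sum_pow_mul_pow]
    rw [show k - j + (k + i) = 2 * k - (j - i) by omega]
  unfold closedSum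
  rw [sum_comm₂₂]
  refine Finset.sum_congr rfl fun u _ => Finset.sum_congr rfl fun v _ => ?_
  simp only [← Finset.mul_sum] at h2 ⊢
  rw [h2]
  ring

/-- A conflict between position `i` of the first and position `j` of the second walk is a conflict
at distance `i + j` on the closed walk that they form. -/
theorem sum_walkMass_cross {F : Matrix V V ℝ} (hF : F.IsSymm) (φ : V → V → ℝ) {k i j : ℕ}
    (hi : i < k + 1) (hj : j < k + 1) :
    ∑ a, ∑ b, ∑ P : Fin (k + 1) → V, ∑ Q : Fin (k + 1) → V, walkMass F a b P * walkMass F a b Q *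
      φ (P ⟨i, hi⟩) (Q ⟨j, hj⟩) = closedSum F φ k (i + j) := by
  have h : ∀ a b, ∑ P : Fin (k + 1) → V, ∑ Q : Fin (k + 1) → V,
      walkMass F a b P * walkMass F a b Q * φ (P ⟨i, hi⟩) (Q ⟨j, hj⟩) =
      ∑ u, ∑ v, φ u v *
        (((F ^ i) u a * (F ^ j) a v) * ((F ^ (k - j)) v b * (F ^ (k - i)) b u)) := by
    intro a b
    calc _ = ∑ P : Fin (k + 1) → V, walkMass F a b P *
          ∑ Q : Fin (k + 1) → V, walkMass F a b Q * φ (P ⟨i, hi⟩) (Q ⟨j, hj⟩) := by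
          simp only [Finset.mul_sum, mul_assoc]
      _ = _ := by
          simp only [sum_walkMass_apply F _ k j hj]
          rw [sum_walkMass_apply F
            (fun x => ∑ u, (F ^ j) a u * φ x u * (F ^ (k - j)) u b) k i hi]
          refine Finset.sum_congr rfl fun u _ => ?_
          rw [Finset.mul_sum, Finset.sum_mul]
          refine Finset.sum_congr rfl fun v _ => ?_
          rw [pow_apply_comm hF i a u, pow_apply_comm hF (k - i) u b]
          ring
  simp only [h]
  unfold closedSum
  rw [sum_comm₂₂]
  refine Finset.sum_congr rfl fun u _ => Finset.sum_congr rfl fun v _ => ?_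
  simp only [← Finset.mul_sum]
  rw [← Finset.sum_mul, sum_pow_mul_pow, sum_pow_mul_pow,
    show k - j + (k - i) = 2 * k - (i + j) by omega]

end ConflictFree

/-! ### Theta graphs without conflicts from weighted walks -/

namespace ConflictFree

open Matrix

open Classical in
/-- If two independent random elements are in the relation `bad` with small probability, then some
`t` elements of positive weight are pairwise not in this relation: discard the elements that are
bad for too many others, and choose from the remaining ones greedily. -/
theorem exists_pairwise_not_bad {W : Type*} [Fintype W] {μ : W → ℝ} (h0 : ∀ x, 0 ≤ μ x)
    (bad : W → W → Prop) {t : ℕ} (hw : 0 < ∑ x, μ x)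
    (h : 16 * t * ∑ x, ∑ y, μ x * μ y * (if bad x y then 1 else 0) ≤ (∑ x, μ x) ^ 2) :
    ∃ f : Fin t → W, (∀ i, 0 < μ (f i)) ∧ ∀ i j, i ≠ j → ¬ bad (f i) (f j) := by
  rcases Nat.eq_zero_or_pos t with rfl | ht
  · exact ⟨fun i => i.elim0, fun i => i.elim0, fun i => i.elim0⟩
  have ht' : (0 : ℝ) < t := by exact_mod_cast ht
  set w := ∑ x, μ x with hwdef
  -- `b x` is the weight of the elements that are bad for `x`. By Markov's inequality the elements
  -- with `b x > w / (2 * t)` weigh at most `w / 4`, and each chosen element excludes weight at most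
  -- `w / (2 * t)`, so fewer than `t` choices leave weight at least `w / 4`.
  set β : W → W → ℝ := fun x y => if bad x y then 1 else 0 with hβ
  have hβ0 : ∀ x y, 0 ≤ β x y := fun x y => by simp only [hβ]; split_ifs <;> norm_num
  set b : W → ℝ := fun x => ∑ y, μ y * (β x y + β y x) with hb
  have hb0 : ∀ x, 0 ≤ b x := fun x =>
    Finset.sum_nonneg fun y _ => mul_nonneg (h0 y) (add_nonneg (hβ0 _ _) (hβ0 _ _))
  have hsum : ∑ x, μ x * b x = 2 * ∑ x, ∑ y, μ x * μ y * β x y := by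
    have h1 : ∀ x, μ x * b x = ∑ y, μ x * μ y * β x y + ∑ y, μ y * μ x * β y x := by
      intro x
      rw [hb, Finset.mul_sum, ← Finset.sum_add_distrib]
      exact Finset.sum_congr rfl fun _ _ => by ring
    simp only [h1, Finset.sum_add_distrib]
    rw [Finset.sum_comm (f := fun x y => μ y * μ x * β y x)]
    ring
  have hM : ∑ x, μ x * (if b x ≤ w / (2 * t) then 0 else 1) ≤ w / 4 := by
    have h1 : (∑ x, μ x * (if b x ≤ w / (2 * t) then 0 else 1)) * (w / (2 * t)) ≤
        ∑ x, μ x * b x := by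
      rw [Finset.sum_mul]
      refine Finset.sum_le_sum fun x _ => ?_
      split_ifs with hx
      · simpa using mul_nonneg (h0 x) (hb0 x)
      · rw [mul_one]
        exact mul_le_mul_of_nonneg_left (not_le.1 hx).le (h0 x)
    have h2 : (∑ x, μ x * (if b x ≤ w / (2 * t) then 0 else 1)) * (w / (2 * t)) ≤
        w / 4 * (w / (2 * t)) := by
      refine h1.trans ?_
      rw [hsum, show w / 4 * (w / (2 * t)) = w ^ 2 / (8 * t) by ring, le_div_iff₀ (by positivity)]
      linarith
    exact le_of_mul_le_mul_right h2 (by positivity)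
  have key : ∀ m ≤ t, ∃ f : Fin m → W, (∀ i, 0 < μ (f i) ∧ b (f i) ≤ w / (2 * t)) ∧
      ∀ i j, i ≠ j → ¬ bad (f i) (f j) := by
    intro m
    induction m with
    | zero => exact fun _ => ⟨fun i => i.elim0, fun i => i.elim0, fun i => i.elim0⟩
    | succ m ih =>
      intro hm
      obtain ⟨f, hf, hf'⟩ := ih (by omega)
      obtain ⟨y, hy0, hy, hyf⟩ : ∃ y, 0 < μ y ∧ b y ≤ w / (2 * t) ∧
          ∀ i, ¬ bad (f i) y ∧ ¬ bad y (f i) := by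
        by_contra! hcon
        have h1 : ∀ y, μ y ≤ μ y * (if b y ≤ w / (2 * t) then 0 else 1) +
            ∑ i, μ y * (β (f i) y + β y (f i)) := by
          intro y
          have hnn : ∀ i, 0 ≤ μ y * (β (f i) y + β y (f i)) := fun i =>
            mul_nonneg (h0 y) (add_nonneg (hβ0 _ _) (hβ0 _ _))
          rcases (h0 y).eq_or_lt with h | h
          · simp [← h]
          · split_ifs with hy
            · obtain ⟨i, hi⟩ := hcon y h hy
              have h2 : μ y ≤ μ y * (β (f i) y + β y (f i)) := by
                refine le_mul_of_one_le_right h.le ?_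
                by_cases h3 : bad (f i) y
                · have : β (f i) y = 1 := if_pos h3
                  linarith [hβ0 y (f i)]
                · have : β y (f i) = 1 := if_pos (hi h3)
                  linarith [hβ0 (f i) y]
              have h3 := Finset.single_le_sum (fun i _ => hnn i) (Finset.mem_univ i)
              linarith
            · have := Finset.sum_nonneg fun i (_ : i ∈ Finset.univ) => hnn i
              linarith
        have h2 : w ≤ w / 4 + ∑ i, b (f i) := by
          calc w ≤ ∑ y, (μ y * (if b y ≤ w / (2 * t) then 0 else 1) +
                ∑ i, μ y * (β (f i) y + β y (f i))) := Finset.sum_le_sum fun y _ => h1 y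
            _ ≤ _ := by
                rw [Finset.sum_add_distrib, Finset.sum_comm]
                exact add_le_add_left hM _
        have h3 : ∑ i, b (f i) ≤ m * (w / (2 * t)) := by
          refine (Finset.sum_le_sum fun i _ => (hf i).2).trans ?_
          simp
        have h4 : (m : ℝ) * (w / (2 * t)) ≤ w / 2 := by
          have : (m : ℝ) ≤ t := by exact_mod_cast (by omega : m ≤ t)
          calc (m : ℝ) * (w / (2 * t)) ≤ t * (w / (2 * t)) :=
                mul_le_mul_of_nonneg_right this (by positivity)
            _ = w / 2 := by field_simp
        linarith
      refine ⟨Fin.cons y f, fun i => ?_, fun i j hij => ?_⟩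
      · refine Fin.cases ⟨hy0, hy⟩ (fun i => ?_) i
        simpa using hf i
      · induction i using Fin.cases with
        | zero =>
          induction j using Fin.cases with
          | zero => exact absurd rfl hij
          | succ j => simpa using (hyf j).2
        | succ i =>
          induction j using Fin.cases with
          | zero => simpa using (hyf i).1
          | succ j => simpa using hf' i j fun h => hij (by rw [h])
  obtain ⟨f, hf, hf'⟩ := key t le_rfl
  exact ⟨f, fun i => (hf i).1, hf'⟩

/-- A theta graph without conflicts: `t` walks of length `k` from `a` to `b` along `Adj`, such that
no two vertices at different positions of a walk, and no two interior vertices of different walks,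
are in the relation `R`. -/
structure IsTheta {V : Type*} (Adj R : V → V → Prop) {t k : ℕ} (a b : V)
    (P : Fin t → Fin (k + 1) → V) : Prop where
  start : ∀ i, P i 0 = a
  finish : ∀ i, P i (Fin.last k) = b
  adj : ∀ i (j : Fin k), Adj (P i j.castSucc) (P i j.succ)
  within : ∀ i u v, u < v → ¬ R (P i u) (P i v)
  cross : ∀ i j, i ≠ j → ∀ u v, 0 < u → u < Fin.last k → 0 < v → v < Fin.last k →
    ¬ R (P i u) (P j v)

section Theta

theorem walkMass_nonneg {V : Type*} [DecidableEq V] {F : Matrix V V ℝ}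
    (h0 : ∀ a b, 0 ≤ F a b) {k : ℕ} (a b : V) (P : Fin (k + 1) → V) : 0 ≤ walkMass F a b P := by
  unfold walkMass
  split_ifs
  · exact Finset.prod_nonneg fun _ _ => h0 _ _
  · exact le_rfl

variable {V : Type*} [Fintype V] [DecidableEq V]

/-- Two walks from `a` to `b` conflict if the closed walk that they form has a conflict between two
positions of the first one, or between interior positions of the two. -/
def WalkConflict (R : V → V → Prop) {k : ℕ} (P Q : Fin (k + 1) → V) : Prop :=
  (∃ u v, u < v ∧ R (P u) (P v)) ∨
    ∃ u v, 0 < u ∧ u < Fin.last k ∧ 0 < v ∧ v < Fin.last k ∧ R (P u) (Q v)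

open Classical in
theorem sum_walkConflict_le {F : Matrix V V ℝ} (hF : F.IsSymm) (h0 : ∀ a b, 0 ≤ F a b)
    {R : V → V → Prop} {k : ℕ} {X : ℝ} (hk : 1 ≤ k) (hX0 : 0 ≤ X)
    (hX : ∀ d, 1 ≤ d → d < 2 * k → closedSum F (fun u v => if R u v then 1 else 0) k d ≤ X) :
    ∑ a, ∑ b, ∑ P : Fin (k + 1) → V, ∑ Q : Fin (k + 1) → V, walkMass F a b P * walkMass F a b Q *
      (if WalkConflict R P Q then 1 else 0) ≤ 2 * (k + 1) ^ 2 * X := by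
  set φ : V → V → ℝ := fun u v => if R u v then 1 else 0 with hφ
  have hφ0 : ∀ u v, 0 ≤ φ u v := fun u v => by simp only [hφ]; split_ifs <;> norm_num
  set f : Fin (k + 1) → Fin (k + 1) → (Fin (k + 1) → V) → (Fin (k + 1) → V) → ℝ :=
    fun u v P Q => (if u < v then φ (P u) (P v) else 0) +
      (if 0 < u ∧ u < Fin.last k ∧ 0 < v ∧ v < Fin.last k then φ (P u) (Q v) else 0) with hf
  have hf0 : ∀ u v P Q, 0 ≤ f u v P Q := by
    intro u v P Q
    simp only [hf]
    refine add_nonneg ?_ ?_ <;> split_ifs <;> first | exact hφ0 _ _ | exact le_rfl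
  have h1 : ∀ P Q : Fin (k + 1) → V, (if WalkConflict R P Q then (1 : ℝ) else 0) ≤
      ∑ u, ∑ v, f u v P Q := by
    intro P Q
    have hnn : 0 ≤ ∑ u, ∑ v, f u v P Q :=
      Finset.sum_nonneg fun u _ => Finset.sum_nonneg fun v _ => hf0 u v P Q
    split_ifs with h
    · have hex : ∃ u v, 1 ≤ f u v P Q := by
        rcases h with ⟨u, v, huv, hR⟩ | ⟨u, v, h1, h2, h3, h4, hR⟩
        · refine ⟨u, v, ?_⟩
          have : 0 ≤ (if 0 < u ∧ u < Fin.last k ∧ 0 < v ∧ v < Fin.last k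
              then φ (P u) (Q v) else 0) := by
            split_ifs
            · exact hφ0 _ _
            · exact le_rfl
          have h2 : φ (P u) (P v) = 1 := if_pos hR
          simp only [hf, if_pos huv, h2]
          linarith
        · refine ⟨u, v, ?_⟩
          have : 0 ≤ (if u < v then φ (P u) (P v) else 0) := by
            split_ifs
            · exact hφ0 _ _
            · exact le_rfl
          have h5 : φ (P u) (Q v) = 1 := if_pos hR
          simp only [hf, if_pos (show 0 < u ∧ u < Fin.last k ∧ 0 < v ∧ v < Fin.last k from
            ⟨h1, h2, h3, h4⟩), h5]
          linarith
      obtain ⟨u, v, huv⟩ := hex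
      refine huv.trans
        ((Finset.single_le_sum (fun v _ => hf0 u v P Q) (Finset.mem_univ v)).trans ?_)
      exact Finset.single_le_sum (f := fun u => ∑ v, f u v P Q)
        (fun u _ => Finset.sum_nonneg fun v _ => hf0 u v P Q) (Finset.mem_univ u)
    · exact hnn
  have hμ := walkMass_nonneg h0 (k := k)
  have h2 : ∀ u v, ∑ a, ∑ b, ∑ P : Fin (k + 1) → V, ∑ Q : Fin (k + 1) → V,
      walkMass F a b P * walkMass F a b Q * f u v P Q ≤ 2 * X := by
    intro u v
    simp only [hf, mul_add, Finset.sum_add_distrib]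
    rw [two_mul]
    refine add_le_add ?_ ?_
    · split_ifs with h
      · have h3 := sum_walkMass_within hF φ (k := k) (Fin.lt_def.1 h) v.2
        exact h3.trans_le (hX _ (by have := Fin.lt_def.1 h; omega) (by omega))
      · simpa using hX0
    · split_ifs with h
      · have h3 := sum_walkMass_cross hF φ (k := k) u.2 v.2
        obtain ⟨h4, h5, h6, h7⟩ := h
        simp only [Fin.lt_def, Fin.val_zero, Fin.val_last] at h4 h5 h6 h7
        exact h3.trans_le (hX _ (by omega) (by omega))
      · simpa using hX0
  calc _ ≤ ∑ a, ∑ b, ∑ P : Fin (k + 1) → V, ∑ Q : Fin (k + 1) → V,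
        walkMass F a b P * walkMass F a b Q * ∑ u, ∑ v, f u v P Q := by
        refine Finset.sum_le_sum fun a _ => Finset.sum_le_sum fun b _ =>
          Finset.sum_le_sum fun P _ => Finset.sum_le_sum fun Q _ => ?_
        exact mul_le_mul_of_nonneg_left (h1 P Q) (mul_nonneg (hμ _ _ _) (hμ _ _ _))
    _ = ∑ u, ∑ v, ∑ a, ∑ b, ∑ P : Fin (k + 1) → V, ∑ Q : Fin (k + 1) → V,
        walkMass F a b P * walkMass F a b Q * f u v P Q := by
        simp only [Finset.mul_sum]
        have : ∀ g : V → V → (Fin (k + 1) → V) → (Fin (k + 1) → V) → Fin (k + 1) → Fin (k + 1) → ℝ,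
            ∑ a, ∑ b, ∑ P, ∑ Q, ∑ u, ∑ v, g a b P Q u v =
            ∑ u, ∑ v, ∑ a, ∑ b, ∑ P, ∑ Q, g a b P Q u v := by
          intro g
          have e := Finset.sum_comm (s := (Finset.univ : Finset (V × V × (Fin (k + 1) → V) ×
            (Fin (k + 1) → V)))) (t := (Finset.univ : Finset (Fin (k + 1) × Fin (k + 1))))
            (f := fun x y => g x.1 x.2.1 x.2.2.1 x.2.2.2 y.1 y.2)
          simpa only [Fintype.sum_prod_type] using e
        exact this _
    _ ≤ ∑ u : Fin (k + 1), ∑ v : Fin (k + 1), 2 * X :=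
        Finset.sum_le_sum fun u _ => Finset.sum_le_sum fun v _ => h2 u v
    _ = _ := by simp; ring

open Classical in
/-- If the total weight of conflicting pairs of walks is small compared with that of all pairs with
common ends, then this holds for some pair `(a, b)` of ends, and `t` walks from `a` to `b` without
conflicts exist. -/
theorem exists_isTheta_of_weights {F : Matrix V V ℝ} (hF : F.IsSymm) (h0 : ∀ a b, 0 ≤ F a b)
    {R : V → V → Prop} (hR : ∀ u v, R u v → R v u) {K : ℕ} {τ : ℝ}
    (hK : ∀ y v, (Finset.univ.filter fun u => F u y ≠ 0 ∧ R u v).card ≤ K)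
    (hτ : ∀ u, ∑ y, F u y ^ 2 ≤ τ) {k t : ℕ} (hk : 1 ≤ k) (ht : 2 ≤ t)
    (hpos : 0 < powNormSq F k)
    (h : (32 * t * (k + 1) ^ 2) ^ 2 * (K * τ * powNormSq F (k - 1)) ≤ powNormSq F k) :
    ∃ (a b : V) (P : Fin t → Fin (k + 1) → V), IsTheta (fun x y => F x y ≠ 0) R a b P := by
  set X : ℝ := powNormSq F k / (32 * t * (k + 1) ^ 2) with hXdef
  have ht0 : (0 : ℝ) < t := by exact_mod_cast (by omega : 0 < t)
  have hc0 : (0 : ℝ) < 32 * t * (k + 1) ^ 2 := by positivity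
  have hX0 : 0 ≤ X := by positivity
  have hX : ∀ d, 1 ≤ d → d < 2 * k →
      closedSum F (fun u v => if R u v then 1 else 0) k d ≤ X := by
    intro d hd1 hd2
    refine le_of_sq_le_sq ((closedSum_sq_le hF h0 ?_ ?_ ?_ (K := K) ?_ hτ hd1 hd2).trans ?_) hX0
    · intro u v; split_ifs <;> norm_num
    · intro u v; split_ifs <;> norm_num
    · intro u v; simp only [show R u v ↔ R v u from ⟨hR u v, hR v u⟩]
    · intro y v
      refine le_trans (le_of_eq ?_) (Nat.cast_le.2 (hK y v))
      rw [Finset.card_filter, Nat.cast_sum]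
      refine Finset.sum_congr rfl fun u _ => ?_
      by_cases h1 : F u y = 0 <;> by_cases h2 : R u v <;> simp [h1, h2]
    · rw [hXdef, div_pow, le_div_iff₀ (by positivity)]
      nlinarith [mul_le_mul_of_nonneg_right h hpos.le]
  have hbad := sum_walkConflict_le hF h0 hk hX0 hX
  have hbad' : 16 * t * ∑ a, ∑ b, ∑ P : Fin (k + 1) → V, ∑ Q : Fin (k + 1) → V,
      walkMass F a b P * walkMass F a b Q * (if WalkConflict R P Q then 1 else 0) ≤
      powNormSq F k := by
    calc _ ≤ 16 * t * (2 * (k + 1) ^ 2 * X) := mul_le_mul_of_nonneg_left hbad (by positivity)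
      _ = powNormSq F k := by rw [hXdef]; field_simp; ring
  obtain ⟨a, b, hab, hab'⟩ : ∃ a b, 0 < (F ^ k) a b ∧
      16 * t * ∑ P : Fin (k + 1) → V, ∑ Q : Fin (k + 1) → V,
        walkMass F a b P * walkMass F a b Q * (if WalkConflict R P Q then 1 else 0) ≤
      (F ^ k) a b ^ 2 := by
    by_contra! hcon
    have hnn : ∀ a b, 0 ≤ 16 * t * ∑ P : Fin (k + 1) → V, ∑ Q : Fin (k + 1) → V,
        walkMass F a b P * walkMass F a b Q * (if WalkConflict R P Q then 1 else 0) := by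
      intro a b
      refine mul_nonneg (by positivity) (Finset.sum_nonneg fun P _ => Finset.sum_nonneg fun Q _ =>
        mul_nonneg (mul_nonneg (walkMass_nonneg h0 _ _ _) (walkMass_nonneg h0 _ _ _)) ?_)
      split_ifs <;> norm_num
    have hle : ∀ a b, (F ^ k) a b ^ 2 ≤ 16 * t * ∑ P : Fin (k + 1) → V, ∑ Q : Fin (k + 1) → V,
        walkMass F a b P * walkMass F a b Q * (if WalkConflict R P Q then 1 else 0) := by
      intro a b
      rcases (pow_apply_nonneg h0 k a b).eq_or_lt with h1 | h1
      · rw [← h1]; simpa using hnn a b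
      · exact (hcon a b h1).le
    obtain ⟨a, b, hab⟩ : ∃ a b, 0 < (F ^ k) a b := by
      by_contra! h1
      refine hpos.ne' (Finset.sum_eq_zero fun a _ => Finset.sum_eq_zero fun b _ => ?_)
      rw [le_antisymm (h1 a b) (pow_apply_nonneg h0 k a b)]; norm_num
    refine absurd hbad' (not_le.2 ?_)
    simp only [Finset.mul_sum (Finset.univ : Finset V)]
    refine Finset.sum_lt_sum (fun a _ => Finset.sum_le_sum fun b _ => hle a b)
      ⟨a, Finset.mem_univ a, Finset.sum_lt_sum (fun b _ => hle a b) ⟨b, Finset.mem_univ b, ?_⟩⟩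
    exact hcon a b hab
  rw [← sum_walkMass] at hab hab'
  obtain ⟨P, hP, hPP⟩ := exists_pairwise_not_bad (walkMass_nonneg h0 a b) _ hab hab'
  have hend : ∀ i, P i 0 = a ∧ P i (Fin.last k) = b := by
    intro i
    by_contra hne
    exact (hP i).ne' (if_neg hne)
  have hother : ∀ i : Fin t, ∃ j, i ≠ j := by
    intro i
    have : Nontrivial (Fin t) := Fin.nontrivial_iff_two_le.2 ht
    obtain ⟨j, hj⟩ := exists_ne i
    exact ⟨j, hj.symm⟩
  refine ⟨a, b, P, ⟨fun i => (hend i).1, fun i => (hend i).2, fun i j hzero => ?_, ?_, ?_⟩⟩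
  · have h1 : walkWeight F (P i) = 0 := Finset.prod_eq_zero (Finset.mem_univ j) hzero
    refine (hP i).ne' ?_
    unfold walkMass
    rw [h1, ite_self]
  · intro i u v huv hRuv
    obtain ⟨j, hj⟩ := hother i
    exact hPP i j hj (Or.inl ⟨u, v, huv, hRuv⟩)
  · intro i j hij u v h1 h2 h3 h4 hRuv
    exact hPP i j hij (Or.inr ⟨u, v, h1, h2, h3, h4, hRuv⟩)

end Theta

end ConflictFree

/-! ### Graphs with many edges contain theta graphs without conflicts -/

namespace ConflictFree

open Matrix

section MinDegree

variable {V : Type*} [Fintype V] [DecidableEq V]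

open Classical in
/-- Some nonempty set `S` spans a graph whose minimum degree is at least a quarter of the average
degree: take `S` with `2 * |V| * e(S) - e(V) * |S|` maximal, where `e` counts ordered pairs. -/
theorem exists_min_degree {A : V → V → Prop} (hA : ∀ u v, A u v → A v u)
    (hE : 0 < (Finset.univ.filter fun p : V × V => A p.1 p.2).card) :
    ∃ S : Finset V, S.Nonempty ∧ ∀ v ∈ S, (Finset.univ.filter fun p : V × V => A p.1 p.2).card ≤
      4 * Fintype.card V * (S.filter fun u => A v u).card := by
  set E := (Finset.univ.filter fun p : V × V => A p.1 p.2).card with hEdef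
  set e : Finset V → ℕ := fun S => ((S ×ˢ S).filter fun p : V × V => A p.1 p.2).card with he
  set N := Fintype.card V with hN
  obtain ⟨S, -, hS⟩ := Finset.exists_max_image (Finset.univ : Finset (Finset V))
    (fun S => (2 * N * e S : ℤ) - E * S.card) ⟨∅, Finset.mem_univ _⟩
  have huniv : e Finset.univ = E := by simp [he, hEdef]
  have hNpos : 0 < N := by
    obtain ⟨p, -⟩ := Finset.card_pos.1 hE
    exact Fintype.card_pos_iff.2 ⟨p.1⟩
  refine ⟨S, ?_, fun v hv => ?_⟩
  · by_contra hne
    rw [Finset.not_nonempty_iff_eq_empty] at hne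
    have h1 := hS Finset.univ (Finset.mem_univ _)
    rw [hne, huniv] at h1
    simp only [he, Finset.card_univ, Finset.empty_product, Finset.filter_empty,
      Finset.card_empty, ← hN] at h1
    have h2 : (0 : ℤ) < N * E := by exact_mod_cast Nat.mul_pos hNpos hE
    push_cast at h1
    nlinarith
  · have h1 := hS (S.erase v) (Finset.mem_univ _)
    have h2 : e S ≤ e (S.erase v) + 2 * (S.filter fun u => A v u).card := by
      have hsub : ((S ×ˢ S).filter fun p : V × V => A p.1 p.2) ⊆
          (((S.erase v) ×ˢ (S.erase v)).filter fun p : V × V => A p.1 p.2) ∪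
          ((S.filter fun u => A v u).image (fun u => (v, u)) ∪
            (S.filter fun u => A v u).image (fun u => (u, v))) := by
        rintro ⟨x, y⟩ hxy
        simp only [Finset.mem_filter, Finset.mem_product] at hxy
        obtain ⟨⟨hx, hy⟩, hxy⟩ := hxy
        simp only [Finset.mem_union, Finset.mem_filter, Finset.mem_product, Finset.mem_erase,
          Finset.mem_image, Prod.mk.injEq]
        by_cases h3 : x = v
        · subst h3
          exact Or.inr (Or.inl ⟨y, ⟨hy, hxy⟩, rfl, rfl⟩)
        · by_cases h4 : y = v
          · subst h4
            exact Or.inr (Or.inr ⟨x, ⟨hx, hA _ _ hxy⟩, rfl, rfl⟩)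
          · exact Or.inl ⟨⟨⟨h3, hx⟩, h4, hy⟩, hxy⟩
      have h3 := (Finset.card_le_card hsub).trans ((Finset.card_union_le _ _).trans
        (Nat.add_le_add_left (Finset.card_union_le _ _) _))
      have h4 := Finset.card_image_le (s := S.filter fun u => A v u) (f := fun u => (v, u))
      have h5 := Finset.card_image_le (s := S.filter fun u => A v u) (f := fun u => (u, v))
      simp only [he]
      omega
    have h3 : ((S.erase v).card : ℤ) = S.card - 1 := by
      rw [Finset.card_erase_of_mem hv, Nat.cast_sub (Finset.card_pos.2 ⟨v, hv⟩)]; rfl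
    rw [h3] at h1
    have h4 : (e S : ℤ) ≤ e (S.erase v) + 2 * (S.filter fun u => A v u).card := by
      exact_mod_cast h2
    have h5 : (2 * N : ℤ) * e S ≤
        2 * N * (e (S.erase v) + 2 * (S.filter fun u => A v u).card) :=
      mul_le_mul_of_nonneg_left h4 (by positivity)
    have h6 : (E : ℤ) ≤ 4 * N * (S.filter fun u => A v u).card := by linarith
    exact_mod_cast h6

/-- If `F` fixes a nonzero vector, then so do its powers, whose Frobenius norms are therefore at
least `1`. -/
theorem one_le_powNormSq {F : Matrix V V ℝ} {x : V → ℝ} (hx : F *ᵥ x = x) (hx0 : x ≠ 0) (j : ℕ) :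
    1 ≤ powNormSq F j := by
  have hj : (F ^ j) *ᵥ x = x := by
    induction j with
    | zero => simp
    | succ j ih => rw [pow_succ, ← Matrix.mulVec_mulVec, hx, ih]
  have hpos : 0 < ∑ a, x a ^ 2 := by
    obtain ⟨a, ha⟩ := Function.ne_iff.1 hx0
    exact Finset.sum_pos' (fun _ _ => sq_nonneg _) ⟨a, Finset.mem_univ a, sq_pos_of_ne_zero ha⟩
  have h1 : ∑ a, x a ^ 2 = ∑ p : V × V, (F ^ j) p.1 p.2 * (x p.1 * x p.2) := by
    rw [Fintype.sum_prod_type]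
    refine Finset.sum_congr rfl fun a _ => ?_
    calc x a ^ 2 = x a * ((F ^ j) *ᵥ x) a := by rw [hj]; ring
      _ = _ := by
        rw [Matrix.mulVec, dotProduct, Finset.mul_sum]
        exact Finset.sum_congr rfl fun _ _ => by ring
  have h2 : (∑ a, x a ^ 2) ^ 2 ≤ powNormSq F j * (∑ a, x a ^ 2) ^ 2 := by
    calc (∑ a, x a ^ 2) ^ 2 = (∑ p : V × V, (F ^ j) p.1 p.2 * (x p.1 * x p.2)) ^ 2 := by rw [← h1]
      _ ≤ _ := Finset.sum_mul_sq_le_sq_mul_sq _ _ _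
      _ = _ := by
        rw [powNormSq, Fintype.sum_prod_type]
        congr 1
        rw [Fintype.sum_prod_type, sq, Finset.sum_mul_sum]
        exact Finset.sum_congr rfl fun _ _ => Finset.sum_congr rfl fun _ _ => by ring
  exact le_of_mul_le_mul_right (by simpa using h2) (by positivity : 0 < (∑ a, x a ^ 2) ^ 2)

open Classical in
/-- The normalized adjacency matrix of a graph of minimum degree at least `δ` on a set `S` of
vertices, with entries `1 / √(d u * d v)`: its rows have square sum at most `1 / δ`, and it fixes
the vector `√d`. -/
theorem exists_weights {A : V → V → Prop} (hA : ∀ u v, A u v → A v u) {S : Finset V}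
    (hne : S.Nonempty) {δ : ℝ} (hδ : 0 < δ)
    (hS : ∀ v ∈ S, δ ≤ ((S.filter fun u => A v u).card : ℝ)) :
    ∃ F : Matrix V V ℝ, F.IsSymm ∧ (∀ u v, 0 ≤ F u v) ∧ (∀ u v, F u v ≠ 0 → A u v) ∧
      (∀ u, ∑ v, F u v ^ 2 ≤ 1 / δ) ∧ ∀ j, 1 ≤ powNormSq F j := by
  obtain ⟨d, hd⟩ : ∃ d : V → ℝ, ∀ v, d v = ((S.filter fun u => A v u).card : ℝ) :=
    ⟨_, fun _ => rfl⟩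
  have hdδ : ∀ v ∈ S, δ ≤ d v := fun v hv => by rw [hd]; exact hS v hv
  have hdpos : ∀ v ∈ S, 0 < d v := fun v hv => hδ.trans_le (hdδ v hv)
  obtain ⟨F, hFdef⟩ : ∃ F : Matrix V V ℝ, ∀ u v, F u v =
      if u ∈ S ∧ v ∈ S ∧ A u v then (√(d u))⁻¹ * (√(d v))⁻¹ else 0 :=
    ⟨fun u v => if u ∈ S ∧ v ∈ S ∧ A u v then (√(d u))⁻¹ * (√(d v))⁻¹ else 0, fun _ _ => rfl⟩
  have hcard : ∀ (u : V) (c : ℝ), ∑ v, (if v ∈ S ∧ A u v then c else 0) = d u * c := by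
    intro u c
    rw [← Finset.sum_filter, Finset.sum_const, nsmul_eq_mul, hd]
    congr 3
    ext y; simp
  refine ⟨F, Matrix.IsSymm.ext fun u v => ?_, fun u v => ?_, fun u v h => ?_, fun u => ?_, ?_⟩
  · rw [hFdef, hFdef]
    by_cases h : u ∈ S ∧ v ∈ S ∧ A u v
    · rw [if_pos h, if_pos ⟨h.2.1, h.1, hA _ _ h.2.2⟩, mul_comm]
    · rw [if_neg h, if_neg fun h' => h ⟨h'.2.1, h'.1, hA _ _ h'.2.2⟩]
  · rw [hFdef]
    split_ifs <;> positivity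
  · by_contra hc
    exact h (by rw [hFdef, if_neg fun h' => hc h'.2.2])
  · by_cases hu : u ∈ S
    · have h1 : ∀ v, F u v ^ 2 ≤ if v ∈ S ∧ A u v then (d u)⁻¹ * (1 / δ) else 0 := by
        intro v
        by_cases hv : v ∈ S ∧ A u v
        · rw [if_pos hv, hFdef, if_pos ⟨hu, hv⟩, mul_pow, inv_pow, inv_pow,
            Real.sq_sqrt (hdpos u hu).le, Real.sq_sqrt (hdpos v hv.1).le, one_div]
          exact mul_le_mul_of_nonneg_left (inv_anti₀ hδ (hdδ v hv.1))
            (inv_nonneg.2 (hdpos u hu).le)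
        · rw [if_neg hv, hFdef, if_neg fun h => hv h.2]
          norm_num
      refine (Finset.sum_le_sum fun v _ => h1 v).trans (le_of_eq ?_)
      rw [hcard, ← mul_assoc, mul_inv_cancel₀ (hdpos u hu).ne', one_mul]
    · have h1 : ∀ v, F u v ^ 2 = 0 := fun v => by
        rw [hFdef, if_neg fun h => hu h.1]; norm_num
      simp only [h1, Finset.sum_const_zero]
      positivity
  · obtain ⟨x, hx⟩ : ∃ x : V → ℝ, ∀ v, x v = if v ∈ S then √(d v) else 0 := ⟨_, fun _ => rfl⟩
    refine one_le_powNormSq (x := x) ?_ ?_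
    · funext u
      rw [Matrix.mulVec, dotProduct, hx u]
      by_cases hu : u ∈ S
      · have h1 : ∀ v, F u v * x v = if v ∈ S ∧ A u v then (√(d u))⁻¹ else 0 := by
          intro v
          by_cases hv : v ∈ S ∧ A u v
          · rw [if_pos hv, hFdef, if_pos ⟨hu, hv⟩, hx, if_pos hv.1, mul_assoc,
              inv_mul_cancel₀ (Real.sqrt_pos.2 (hdpos v hv.1)).ne', mul_one]
          · rw [if_neg hv, hFdef, if_neg fun h => hv h.2, zero_mul]
        simp only [h1]
        rw [hcard, if_pos hu, ← div_eq_mul_inv, Real.div_sqrt]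
      · have h1 : ∀ v, F u v * x v = 0 := fun v => by
          rw [hFdef, if_neg fun h => hu h.1, zero_mul]
        simp only [h1, Finset.sum_const_zero, if_neg hu]
    · obtain ⟨v₀, hv₀⟩ := hne
      refine Function.ne_iff.2 ⟨v₀, ?_⟩
      rw [hx, if_pos hv₀]
      exact (Real.sqrt_pos.2 (hdpos v₀ hv₀)).ne'

/-- The threshold constant of `exists_isTheta`. -/
def thetaConst (t k K : ℕ) : ℕ := 4 * ((32 * t * (k + 1) ^ 2) ^ 2 * K)

open Classical in
/-- The Faudree–Simonovits bound for theta graphs, in the presence of conflicts. The walks are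
weighted by the normalized adjacency matrix of a subgraph of large minimum degree. -/
theorem exists_isTheta {A R : V → V → Prop} (hA : ∀ u v, A u v → A v u)
    (hR : ∀ u v, R u v → R v u) {K k t : ℕ} (hK0 : 0 < K)
    (hK : ∀ y v, (Finset.univ.filter fun u => A u y ∧ R u v).card ≤ K)
    (hk : 1 ≤ k) (ht : 2 ≤ t) (hV : 0 < Fintype.card V)
    (h : thetaConst t k K ^ k * Fintype.card V ^ (k + 1) ≤
      (Finset.univ.filter fun p : V × V => A p.1 p.2).card ^ k) :
    ∃ (a b : V) (P : Fin t → Fin (k + 1) → V), IsTheta A R a b P := by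
  set E := (Finset.univ.filter fun p : V × V => A p.1 p.2).card with hEdef
  set N := Fintype.card V with hN
  have hB0 : 0 < thetaConst t k K := by unfold thetaConst; positivity
  have hE : 0 < E := by
    rcases Nat.eq_zero_or_pos E with h1 | h1
    · rw [h1, zero_pow (by omega)] at h
      exact absurd h (not_le.2 (by positivity))
    · exact h1
  obtain ⟨S, ⟨v₀, hv₀⟩, hS⟩ := exists_min_degree hA hE
  rw [← hEdef, ← hN] at hS
  have hNr : (0 : ℝ) < N := by exact_mod_cast hV
  have hEr : (0 : ℝ) < E := by exact_mod_cast hE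
  obtain ⟨F, hF, h0, hFne, hτ, hone⟩ := exists_weights hA ⟨v₀, hv₀⟩
    (δ := E / (4 * N)) (by positivity) fun v hv => by
      rw [div_le_iff₀ (by positivity), mul_comm]
      exact_mod_cast hS v hv
  rw [one_div_div] at hτ
  have hlog := pow_succ_le_of_sq_le (a := powNormSq F) (fun j => one_pos.trans_le (hone j))
    (powNormSq_sq_le hF) (k - 1)
  rw [Nat.sub_add_cancel hk, powNormSq_zero, ← hN] at hlog
  have hmain : (32 * t * (k + 1) ^ 2 : ℝ) ^ 2 * (K * (4 * N / E) * powNormSq F (k - 1)) ≤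
      powNormSq F k := by
    have hp := powNormSq_nonneg F (k - 1)
    refine le_of_pow_le_pow_left₀ (n := k) (by omega) (powNormSq_nonneg F k) ?_
    have h1 : (thetaConst t k K : ℝ) ^ k * N ^ (k + 1) ≤ E ^ k := by exact_mod_cast h
    have h2 : (32 * t * (k + 1) ^ 2 : ℝ) ^ 2 * (K * (4 * N / E) * powNormSq F (k - 1)) =
        (thetaConst t k K * N / E) * powNormSq F (k - 1) := by
      unfold thetaConst; push_cast; ring
    rw [h2, mul_pow]
    calc (thetaConst t k K * N / E : ℝ) ^ k * powNormSq F (k - 1) ^ k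
        ≤ (thetaConst t k K * N / E : ℝ) ^ k * (N * powNormSq F k ^ (k - 1)) :=
          mul_le_mul_of_nonneg_left hlog (by positivity)
      _ = (thetaConst t k K : ℝ) ^ k * N ^ (k + 1) / E ^ k * powNormSq F k ^ (k - 1) := by
          rw [div_pow, mul_pow]; ring
      _ ≤ 1 * powNormSq F k ^ (k - 1) :=
          mul_le_mul_of_nonneg_right ((div_le_one (by positivity)).2 h1)
            (pow_nonneg (powNormSq_nonneg F k) _)
      _ ≤ powNormSq F k ^ k := by
          rw [one_mul]
          exact pow_le_pow_right₀ (hone k) (by omega)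
  obtain ⟨a, b, P, hP⟩ := exists_isTheta_of_weights hF h0 hR (K := K) (fun y v =>
    (Finset.card_le_card fun u hu => by
      simp only [Finset.mem_filter, Finset.mem_univ, true_and] at hu ⊢
      exact ⟨hFne _ _ hu.1, hu.2⟩).trans (hK y v)) hτ hk ht
    (one_pos.trans_le (hone k)) hmain
  exact ⟨a, b, P, hP.start, hP.finish, fun i j => hFne _ _ (hP.adj i j), hP.within,
    hP.cross⟩

end MinDegree

end ConflictFree

/-! ### Color repetitions and monochromatic matchings -/

namespace ErdosGyarfas

/-- The form in which the local condition is used: `χ` is a coloring of the edges of a complete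
bipartite graph with parts `α` and `β`, and a set `T` of edges that meets at most `p` vertices of
each part, and so extends to a copy of `K_{p,p}`, has at most `p ^ 2 - q` color repetitions. -/
def FewRepeats {α β κ : Type*} [DecidableEq α] [DecidableEq β] [DecidableEq κ]
    (χ : α → β → κ) (p q : ℕ) : Prop :=
  ∀ T : Finset (α × β), (T.image Prod.fst).card ≤ p → (T.image Prod.snd).card ≤ p →
    T.card + q ≤ p ^ 2 + (T.image fun e => χ e.1 e.2).card

theorem FewRepeats.swap {α β κ : Type*} [DecidableEq α] [DecidableEq β] [DecidableEq κ]
    {χ : α → β → κ} {p q : ℕ} (h : FewRepeats χ p q) : FewRepeats (fun b a => χ a b) p q := by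
  intro T h1 h2
  have h3 := h (T.map (Equiv.prodComm β α).toEmbedding)
    (by rw [Finset.map_eq_image, Finset.image_image]; exact h2)
    (by rw [Finset.map_eq_image, Finset.image_image]; exact h1)
  rw [Finset.card_map, Finset.map_eq_image, Finset.image_image] at h3
  exact h3

theorem fewRepeats_of_isHQColoring {n p q : ℕ} {κ : Type*} [DecidableEq κ] (hpn : p ≤ n)
    {C : (completeBipartiteGraph (Fin n) (Fin n)).EdgeLabeling κ}
    (hC : IsHQColoring (completeBipartiteGraph (Fin p) (Fin p)) q C) :
    FewRepeats (fun a b : Fin n => C ⟨s(Sum.inl a, Sum.inr b), by simp⟩) p q := by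
  intro T h1 h2
  set χ : Fin n × Fin n → κ := fun e => C ⟨s(Sum.inl e.1, Sum.inr e.2), by simp⟩ with hχ
  obtain ⟨U, hU, hUp⟩ := Finset.exists_superset_card_eq h1 (by simpa using hpn)
  obtain ⟨W, hW, hWp⟩ := Finset.exists_superset_card_eq h2 (by simpa using hpn)
  set u := U.orderEmbOfFin hUp
  set w := W.orderEmbOfFin hWp
  let f : (completeBipartiteGraph (Fin p) (Fin p)).Copy (completeBipartiteGraph (Fin n) (Fin n)) :=
    ⟨⟨Sum.map u w, by
      rintro (a | a) (b | b) <;> simp⟩, Sum.map_injective.2 ⟨u.injective, w.injective⟩⟩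
  have hsub : (Set.range fun e : (completeBipartiteGraph (Fin p) (Fin p)).edgeSet =>
      C (f.mapEdgeSet e)) ⊆ ((U ×ˢ W).image χ : Finset κ) := by
    have hpair : ∀ a b, (s(Sum.inl a, Sum.inr b) : Sym2 (Fin p ⊕ Fin p)) ∈
        (completeBipartiteGraph (Fin p) (Fin p)).edgeSet := by simp
    have key : ∀ a b, C (f.mapEdgeSet ⟨s(Sum.inl a, Sum.inr b), hpair a b⟩) ∈
        ((U ×ˢ W).image χ : Finset κ) := fun a b =>
      Finset.mem_image.2 ⟨(u a, w b), Finset.mem_product.2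
        ⟨Finset.orderEmbOfFin_mem U hUp a, Finset.orderEmbOfFin_mem W hWp b⟩, rfl⟩
    rintro _ ⟨⟨e, he⟩, rfl⟩
    induction e using Sym2.ind with
    | _ x y =>
      rcases x with a | a <;> rcases y with b | b
      · simp at he
      · exact key a b
      · have : (⟨s(Sum.inr a, Sum.inl b), he⟩ :
            (completeBipartiteGraph (Fin p) (Fin p)).edgeSet) =
            ⟨s(Sum.inl b, Sum.inr a), hpair b a⟩ := Subtype.ext Sym2.eq_swap
        simp only [this]
        exact key b a
      · simp at he
  have hq : q ≤ ((U ×ˢ W).image χ).card := by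
    have h3 := (hC f).trans (Set.encard_le_encard hsub)
    rw [Set.encard_coe_eq_coe_finsetCard] at h3
    exact_mod_cast h3
  have hT : T ⊆ U ×ˢ W := fun e he => Finset.mem_product.2
    ⟨hU (Finset.mem_image_of_mem _ he), hW (Finset.mem_image_of_mem _ he)⟩
  have hle : ((U ×ˢ W).image χ).card ≤ (T.image χ).card + ((U ×ˢ W) \ T).card := by
    rw [← Finset.union_sdiff_of_subset hT, Finset.image_union, Finset.union_sdiff_of_subset hT]
    exact (Finset.card_union_le _ _).trans (Nat.add_le_add_left Finset.card_image_le _)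
  have hcard := Finset.card_sdiff_add_card_eq_card hT
  rw [Finset.card_product, hUp, hWp] at hcard
  rw [sq]
  change T.card + q ≤ p * p + (T.image χ).card
  omega

section Stars

variable {α β κ : Type*} [DecidableEq α] [DecidableEq β] [DecidableEq κ]

/-- If two leaves `b`, `b'` of a monochromatic star with `p` leaves received equal colors from `p`
vertices, then the star and the pairs of edges from `b`, `b'` to these vertices would together have
`2 * p - 2` repetitions. -/
theorem FewRepeats.card_lt [Fintype α] [Fintype β] {χ : α → β → κ} {p q : ℕ}
    (h : FewRepeats χ p q) (hp : 2 ≤ p) (hq : p ^ 2 + 2 < 2 * p + q) {a : α} {b b' : β}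
    (hbb : b ≠ b') (hab : χ a b = χ a b')
    (hstar : p ≤ (Finset.univ.filter fun b' => χ a b' = χ a b).card) :
    (Finset.univ.filter fun a' => χ a' b = χ a' b').card < p := by
  by_contra! hcon
  obtain ⟨L, hL1, hL2, hLp⟩ := Finset.exists_subsuperset_card_eq
    (s := {b, b'}) (t := Finset.univ.filter fun b' => χ a b' = χ a b) (n := p)
    (by intro x hx
        rcases Finset.mem_insert.1 hx with rfl | hx
        · simp
        · rw [Finset.mem_singleton.1 hx]; simp [hab])
    (by rw [Finset.card_pair hbb]; exact hp) hstar
  obtain ⟨Z, hZ1, hZ2, hZp⟩ := Finset.exists_subsuperset_card_eq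
    (s := {a}) (t := Finset.univ.filter fun a' => χ a' b = χ a' b') (n := p)
    (by simpa using hab) (by rw [Finset.card_singleton]; omega) hcon
  have haZ : a ∈ Z := hZ1 (Finset.mem_singleton_self a)
  have hZe : (Z.erase a).card = p - 1 := by rw [Finset.card_erase_of_mem haZ, hZp]
  have hdisj : Disjoint (Z.erase a ×ˢ {b, b'}) ({a} ×ˢ L) := by
    rw [Finset.disjoint_left]
    rintro ⟨x, y⟩ h1 h2
    simp only [Finset.mem_product, Finset.mem_erase, Finset.mem_singleton] at h1 h2
    exact h1.1.1 h2.1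
  have hcard : (Z.erase a ×ˢ {b, b'} ∪ {a} ×ˢ L).card = (p - 1) * 2 + p := by
    rw [Finset.card_union_of_disjoint hdisj, Finset.card_product, Finset.card_product, hZe,
      Finset.card_pair hbb, hLp, Finset.card_singleton, one_mul]
  have h1 := h (Z.erase a ×ˢ {b, b'} ∪ {a} ×ˢ L) ?_ ?_
  · have h2 : ((Z.erase a ×ˢ {b, b'} ∪ {a} ×ˢ L).image fun e => χ e.1 e.2).card ≤
        (p - 1) + 1 := by
      refine (Finset.card_le_card (t := insert (χ a b) ((Z.erase a).image fun x => χ x b))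
        ?_).trans ((Finset.card_insert_le _ _).trans
          (Nat.add_le_add_right (Finset.card_image_le.trans hZe.le) 1))
      intro c hc
      obtain ⟨⟨x, y⟩, he, rfl⟩ := Finset.mem_image.1 hc
      rcases Finset.mem_union.1 he with he | he
      · obtain ⟨hx, hy⟩ := Finset.mem_product.1 he
        refine Finset.mem_insert_of_mem (Finset.mem_image.2 ⟨x, hx, ?_⟩)
        have hxx := (Finset.mem_filter.1 (hZ2 (Finset.mem_of_mem_erase hx))).2
        rcases Finset.mem_insert.1 hy with hy | hy
        · rw [hy]
        · rw [Finset.mem_singleton.1 hy]; exact hxx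
      · obtain ⟨hx, hy⟩ := Finset.mem_product.1 he
        simp only [Finset.mem_singleton] at hx
        subst hx
        exact Finset.mem_insert.2 (Or.inl (Finset.mem_filter.1 (hL2 hy)).2)
    omega
  · refine (Finset.card_le_card (t := Z) ?_).trans hZp.le
    intro x hx
    obtain ⟨e, he, rfl⟩ := Finset.mem_image.1 hx
    rcases Finset.mem_union.1 he with he | he
    · exact Finset.mem_of_mem_erase (Finset.mem_product.1 he).1
    · rw [Finset.mem_singleton.1 (Finset.mem_product.1 he).1]; exact haZ
  · refine (Finset.card_le_card (t := L) ?_).trans hLp.le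
    intro x hx
    obtain ⟨e, he, rfl⟩ := Finset.mem_image.1 hx
    rcases Finset.mem_union.1 he with he | he
    · exact hL1 (Finset.mem_product.1 he).2
    · exact (Finset.mem_product.1 he).2

/-- Few edges lie in monochromatic stars with more than `d` leaves: count the pairs of leaves. -/
theorem FewRepeats.card_filter_mul_le [Fintype α] [Fintype β] {χ : α → β → κ} {p q d : ℕ}
    (h : FewRepeats χ p q) (hp : 2 ≤ p) (hq : p ^ 2 + 2 < 2 * p + q) (hd : p ≤ d) :
    (Finset.univ.filter fun e : α × β =>
      d < (Finset.univ.filter fun b => χ e.1 b = χ e.1 e.2).card).card * d ≤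
      Fintype.card β ^ 2 * p := by
  have h1 := Finset.card_mul_le_card_mul (s := Finset.univ.filter fun e : α × β =>
      d < (Finset.univ.filter fun b => χ e.1 b = χ e.1 e.2).card)
    (t := (Finset.univ : Finset (β × β)))
    (r := fun e f => f.1 = e.2 ∧ f.2 ≠ e.2 ∧ χ e.1 f.2 = χ e.1 e.2) (m := d) (n := p) ?_ ?_
  · rwa [Finset.card_univ, Fintype.card_prod, ← sq] at h1
  · rintro ⟨a, b⟩ he
    have hd' := (Finset.mem_filter.1 he).2
    have h2 : d ≤ ((Finset.univ.filter fun b' => χ a b' = χ a b).erase b).card := by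
      rw [Finset.card_erase_of_mem (by simp)]
      simp only at hd'
      omega
    rw [← Finset.card_image_of_injective _ (Prod.mk_right_injective b)] at h2
    refine h2.trans (Finset.card_le_card ?_)
    intro f hf
    obtain ⟨b', hb', rfl⟩ := Finset.mem_image.1 hf
    simp only [Finset.mem_erase, Finset.mem_filter, Finset.mem_univ, true_and] at hb'
    simpa [Finset.bipartiteAbove] using hb'
  · rintro ⟨b, b'⟩ -
    by_contra! hcon
    have hsub : Finset.bipartiteBelow (fun (e : α × β) (f : β × β) =>
        f.1 = e.2 ∧ f.2 ≠ e.2 ∧ χ e.1 f.2 = χ e.1 e.2) (Finset.univ.filter fun e : α × β =>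
        d < (Finset.univ.filter fun b => χ e.1 b = χ e.1 e.2).card) (b, b') ⊆
        (Finset.univ.filter fun a' => χ a' b = χ a' b').image fun a' => (a', b) := by
      rintro ⟨x, y⟩ he
      simp only [Finset.bipartiteBelow, Finset.mem_filter, Finset.mem_univ, true_and] at he
      obtain ⟨-, rfl, -, h3⟩ := he
      simp only [Finset.mem_image, Finset.mem_filter, Finset.mem_univ, true_and]
      exact ⟨x, h3.symm, rfl⟩
    obtain ⟨⟨x, y⟩, he⟩ := Finset.card_pos.1 ((Nat.zero_le p).trans_lt hcon)
    simp only [Finset.bipartiteBelow, Finset.mem_filter, Finset.mem_univ, true_and] at he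
    obtain ⟨h2, rfl, h3, h4⟩ := he
    have h5 := h.card_lt hp hq (Ne.symm h3) h4.symm (hd.trans h2.le)
    have h6 := (Finset.card_le_card hsub).trans Finset.card_image_le
    omega

/-- No two edges in `M` share a vertex. -/
def IsMatchingSet (M : Finset (α × β)) : Prop :=
  ∀ e ∈ M, ∀ f ∈ M, e.1 = f.1 ∨ e.2 = f.2 → e = f

/-- A maximal matching meets every edge, so it has a positive proportion of the edges of a graph of
bounded degree. -/
theorem exists_isMatchingSet (E : Finset (α × β)) {d : ℕ}
    (h1 : ∀ a, (E.filter fun e => e.1 = a).card ≤ d)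
    (h2 : ∀ b, (E.filter fun e => e.2 = b).card ≤ d) :
    ∃ M ⊆ E, IsMatchingSet M ∧ E.card ≤ 2 * d * M.card := by
  classical
  obtain ⟨M, hM, hmax⟩ := Finset.exists_max_image (E.powerset.filter IsMatchingSet) Finset.card
    ⟨∅, by simp [IsMatchingSet]⟩
  simp only [Finset.mem_filter, Finset.mem_powerset] at hM hmax
  refine ⟨M, hM.1, hM.2, ?_⟩
  have hsub : E ⊆ M.biUnion fun m =>
      (E.filter fun e => e.1 = m.1) ∪ E.filter fun e => e.2 = m.2 := by
    intro e he
    by_contra hcon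
    simp only [Finset.mem_biUnion, Finset.mem_union, Finset.mem_filter, he, true_and,
      not_exists, not_and, not_or] at hcon
    have heM : e ∉ M := fun h => (hcon e h).1 rfl
    have h3 := hmax (insert e M) ⟨Finset.insert_subset he hM.1, ?_⟩
    · rw [Finset.card_insert_of_notMem heM] at h3
      omega
    · intro x hx y hy hxy
      rcases Finset.mem_insert.1 hx with rfl | hx' <;>
        rcases Finset.mem_insert.1 hy with rfl | hy'
      · rfl
      · rcases hxy with h | h
        · exact absurd h (hcon y hy').1
        · exact absurd h (hcon y hy').2
      · rcases hxy with h | h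
        · exact absurd h.symm (hcon x hx').1
        · exact absurd h.symm (hcon x hx').2
      · exact hM.2 x hx' y hy' hxy
  refine (Finset.card_le_card hsub).trans ((Finset.card_biUnion_le_card_mul _ _ (2 * d)
    fun m _ => (Finset.card_union_le _ _).trans ?_).trans (mul_comm _ _).le)
  have := h1 m.1
  have := h2 m.2
  omega

/-- Monochromatic matchings, one for each color, that together have a positive proportion of the
edges. -/
theorem FewRepeats.exists_matchings {n p q : ℕ} [Fintype κ] {χ : Fin n → Fin n → κ}
    (h : FewRepeats χ p q) (hp : 2 ≤ p) (hq : p ^ 2 + 2 < 2 * p + q) :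
    ∃ M : κ → Finset (Fin n × Fin n), (∀ c, ∀ e ∈ M c, χ e.1 e.2 = c) ∧
      (∀ c, IsMatchingSet (M c)) ∧ n ^ 2 ≤ 16 * p * ∑ c, (M c).card := by
  -- `B₁` and `B₂` are the edges in large monochromatic stars centred on the left and on the right.
  -- With the bound `4 * p` on the size of a star, each of them has at most `n ^ 2 / 4` edges.
  set B₁ := Finset.univ.filter fun e : Fin n × Fin n =>
    4 * p < (Finset.univ.filter fun b => χ e.1 b = χ e.1 e.2).card with hB₁
  set B₂ := Finset.univ.filter fun e : Fin n × Fin n =>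
    4 * p < (Finset.univ.filter fun a => χ a e.2 = χ e.1 e.2).card with hB₂
  set G := Finset.univ \ (B₁ ∪ B₂) with hG
  have hb1 : B₁.card * 4 ≤ n ^ 2 := by
    have h1 := h.card_filter_mul_le hp hq (d := 4 * p) (by omega)
    rw [Fintype.card_fin] at h1
    have h2 : B₁.card * 4 * p ≤ n ^ 2 * p := by rw [mul_assoc]; exact h1
    exact Nat.le_of_mul_le_mul_right h2 (by omega)
  have hb2 : B₂.card * 4 ≤ n ^ 2 := by
    have h1 := h.swap.card_filter_mul_le hp hq (d := 4 * p) (by omega)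
    rw [Fintype.card_fin] at h1
    have h3 : B₂.card = (Finset.univ.filter fun e : Fin n × Fin n =>
        4 * p < (Finset.univ.filter fun b => χ b e.1 = χ e.2 e.1).card).card := by
      rw [← Finset.card_map (Equiv.prodComm (Fin n) (Fin n)).toEmbedding]
      congr 1
      ext ⟨x, y⟩
      simp [hB₂]
    rw [← h3] at h1
    have h2 : B₂.card * 4 * p ≤ n ^ 2 * p := by rw [mul_assoc]; exact h1
    exact Nat.le_of_mul_le_mul_right h2 (by omega)
  have hGc : n ^ 2 ≤ 2 * G.card := by
    have h1 := Finset.card_sdiff_add_card_eq_card (Finset.subset_univ (B₁ ∪ B₂))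
    rw [Finset.card_univ, Fintype.card_prod, Fintype.card_fin, ← sq, ← hG] at h1
    have h2 := Finset.card_union_le B₁ B₂
    omega
  have hGmem : ∀ e ∈ G, (Finset.univ.filter fun b => χ e.1 b = χ e.1 e.2).card ≤ 4 * p ∧
      (Finset.univ.filter fun a => χ a e.2 = χ e.1 e.2).card ≤ 4 * p := by
    intro e he
    simpa [hG, hB₁, hB₂] using he
  have hex : ∀ c, ∃ M ⊆ G.filter (fun e => χ e.1 e.2 = c), IsMatchingSet M ∧
      (G.filter fun e => χ e.1 e.2 = c).card ≤ 2 * (4 * p) * M.card := by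
    intro c
    refine exists_isMatchingSet _ (fun a => ?_) fun b => ?_
    · rcases Finset.eq_empty_or_nonempty
        ((G.filter fun e => χ e.1 e.2 = c).filter fun e => e.1 = a) with h0 | ⟨⟨x, y⟩, h0⟩
      · rw [h0]; exact Nat.zero_le _
      · simp only [Finset.mem_filter] at h0
        obtain ⟨⟨h1, rfl⟩, rfl⟩ := h0
        refine le_trans ?_ (hGmem _ h1).1
        refine Finset.card_le_card_of_injOn Prod.snd ?_ ?_
        · rintro ⟨u, v⟩ huv
          simp only [Finset.coe_filter, Finset.mem_filter, Set.mem_ofPred_eq] at huv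
          obtain ⟨⟨-, h2⟩, rfl⟩ := huv
          simpa using h2
        · rintro ⟨u, v⟩ huv ⟨u', v'⟩ huv' heq
          simp only [Finset.coe_filter, Finset.mem_filter, Set.mem_ofPred_eq] at huv huv' heq
          rw [huv.2, huv'.2, heq]
    · rcases Finset.eq_empty_or_nonempty
        ((G.filter fun e => χ e.1 e.2 = c).filter fun e => e.2 = b) with h0 | ⟨⟨x, y⟩, h0⟩
      · rw [h0]; exact Nat.zero_le _
      · simp only [Finset.mem_filter] at h0
        obtain ⟨⟨h1, rfl⟩, rfl⟩ := h0
        refine le_trans ?_ (hGmem _ h1).2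
        refine Finset.card_le_card_of_injOn Prod.fst ?_ ?_
        · rintro ⟨u, v⟩ huv
          simp only [Finset.coe_filter, Finset.mem_filter, Set.mem_ofPred_eq] at huv
          obtain ⟨⟨-, h2⟩, rfl⟩ := huv
          simpa using h2
        · rintro ⟨u, v⟩ huv ⟨u', v'⟩ huv' heq
          simp only [Finset.coe_filter, Finset.mem_filter, Set.mem_ofPred_eq] at huv huv' heq
          rw [huv.2, huv'.2, heq]
  choose M hM1 hM2 hM3 using hex
  refine ⟨M, fun c e he => (Finset.mem_filter.1 (hM1 c he)).2, hM2, ?_⟩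
  have h1 : G.card = ∑ c, (G.filter fun e => χ e.1 e.2 = c).card :=
    Finset.card_eq_sum_card_fiberwise fun e _ => Finset.mem_coe.2 (Finset.mem_univ _)
  have h2 : G.card ≤ 2 * (4 * p) * ∑ c, (M c).card := by
    rw [h1, Finset.mul_sum]
    exact Finset.sum_le_sum fun c _ => hM3 c
  calc n ^ 2 ≤ 2 * G.card := hGc
    _ ≤ 2 * (2 * (4 * p) * ∑ c, (M c).card) := Nat.mul_le_mul_left _ h2
    _ = _ := by ring

end Stars

end ErdosGyarfas

/-! ### The color energy graph -/

namespace ErdosGyarfas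

open ConflictFree

section Energy

variable {α β κ : Type*} {r : ℕ}

/-- The color energy relation for the matchings `M c`: the `r` edges `(x i, y i)` are distinct and
lie in the same matching. -/
def EnergyRel (M : κ → Finset (α × β)) (x : Fin r → α) (y : Fin r → β) : Prop :=
  Function.Injective x ∧ Function.Injective y ∧ ∃ c, ∀ i, (x i, y i) ∈ M c

/-- The color energy graph: a bipartite graph whose vertices are the `r`-tuples of vertices in one
part. -/
def EnergyAdj (M : κ → Finset (α × β)) :
    (Fin r → α) ⊕ (Fin r → β) → (Fin r → α) ⊕ (Fin r → β) → Prop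
  | .inl x, .inr y => EnergyRel M x y
  | .inr y, .inl x => EnergyRel M x y
  | _, _ => False

/-- Two tuples in the same part conflict if they have a vertex in common. -/
def Conflict : (Fin r → α) ⊕ (Fin r → β) → (Fin r → α) ⊕ (Fin r → β) → Prop
  | .inl x, .inl x' => ∃ i j, x i = x' j
  | .inr y, .inr y' => ∃ i j, y i = y' j
  | _, _ => False

theorem EnergyAdj.symm (M : κ → Finset (α × β)) (u v : (Fin r → α) ⊕ (Fin r → β))
    (h : EnergyAdj M u v) : EnergyAdj M v u := by
  rcases u with x | y <;> rcases v with x' | y' <;> exact h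

theorem Conflict.symm (u v : (Fin r → α) ⊕ (Fin r → β)) (h : Conflict u v) : Conflict v u := by
  rcases u with x | y <;> rcases v with x' | y'
  · obtain ⟨i, j, hij⟩ := h; exact ⟨j, i, hij.symm⟩
  · exact h
  · exact h
  · obtain ⟨i, j, hij⟩ := h; exact ⟨j, i, hij.symm⟩

open Classical in
/-- If a tuple satisfying `Q` is determined by any of its entries together with its position, then
at most `r ^ 2` such tuples share an entry with a given tuple. -/
theorem card_filter_common_le [Fintype α] (Q : (Fin r → α) → Prop)
    (hQ : ∀ x x', Q x → Q x' → ∀ i, x i = x' i → x = x') (v : Fin r → α) :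
    (Finset.univ.filter fun x => Q x ∧ ∃ i j, x i = v j).card ≤ r ^ 2 := by
  have hsub : (Finset.univ.filter fun x => Q x ∧ ∃ i j, x i = v j) ⊆
      (Finset.univ : Finset (Fin r × Fin r)).biUnion fun ij =>
        Finset.univ.filter fun x => Q x ∧ x ij.1 = v ij.2 := by
    intro x hx
    obtain ⟨hx1, i, j, hij⟩ := (Finset.mem_filter.1 hx).2
    exact Finset.mem_biUnion.2 ⟨(i, j), Finset.mem_univ _,
      Finset.mem_filter.2 ⟨Finset.mem_univ _, hx1, hij⟩⟩
  refine (Finset.card_le_card hsub).trans ((Finset.card_biUnion_le_card_mul _ _ 1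
    fun ij _ => ?_).trans ?_)
  · refine Finset.card_le_one.2 fun x hx x' hx' => ?_
    simp only [Finset.mem_filter, Finset.mem_univ, true_and] at hx hx'
    exact hQ x x' hx.1 hx'.1 ij.1 (hx.2.trans hx'.2.symm)
  · simp [sq]

variable {χ : α → β → κ} {M : κ → Finset (α × β)}

theorem EnergyRel.left_ext (hχ : ∀ c, ∀ e ∈ M c, χ e.1 e.2 = c) (hM : ∀ c, IsMatchingSet (M c))
    {x x' : Fin r → α} {y : Fin r → β} (h : EnergyRel M x y) (h' : EnergyRel M x' y) {i : Fin r}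
    (hi : x i = x' i) : x = x' := by
  obtain ⟨-, -, c, hc⟩ := h
  obtain ⟨-, -, c', hc'⟩ := h'
  have hcc : c = c' := by rw [← hχ c _ (hc i), ← hχ c' _ (hc' i), hi]
  subst hcc
  funext l
  exact congrArg Prod.fst (hM c _ (hc l) _ (hc' l) (Or.inr rfl))

theorem EnergyRel.right_ext (hχ : ∀ c, ∀ e ∈ M c, χ e.1 e.2 = c) (hM : ∀ c, IsMatchingSet (M c))
    {x : Fin r → α} {y y' : Fin r → β} (h : EnergyRel M x y) (h' : EnergyRel M x y') {i : Fin r}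
    (hi : y i = y' i) : y = y' := by
  obtain ⟨-, -, c, hc⟩ := h
  obtain ⟨-, -, c', hc'⟩ := h'
  have hcc : c = c' := by rw [← hχ c _ (hc i), ← hχ c' _ (hc' i), hi]
  subst hcc
  funext l
  exact congrArg Prod.snd (hM c _ (hc l) _ (hc' l) (Or.inl rfl))

open Classical in
/-- Since every color class is a matching, a neighbour of a given tuple is determined by any one of
its vertices, so few neighbours conflict with a given tuple. -/
theorem card_conflict_le [Fintype α] [Fintype β] (hχ : ∀ c, ∀ e ∈ M c, χ e.1 e.2 = c)
    (hM : ∀ c, IsMatchingSet (M c)) (w v : (Fin r → α) ⊕ (Fin r → β)) :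
    (Finset.univ.filter fun u => EnergyAdj M u w ∧ Conflict u v).card ≤ r ^ 2 := by
  rcases w with x | y
  · rcases v with x' | y'
    · rw [Finset.card_eq_zero.2]
      · exact Nat.zero_le _
      · refine Finset.filter_eq_empty_iff.2 ?_
        rintro (u | u) - ⟨h1, h2⟩
        · exact h1
        · exact h2
    · refine le_trans ?_ (card_filter_common_le (fun y => EnergyRel M x y)
        (fun y₁ y₂ h1 h2 i hi => h1.right_ext hχ hM h2 hi) y')
      refine (Finset.card_le_card ?_).trans (Finset.card_image_le (f := Sum.inr))
      rintro (u | u) hu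
      · exact ((Finset.mem_filter.1 hu).2.2 : False).elim
      · exact Finset.mem_image_of_mem _ (Finset.mem_filter.2
          ⟨Finset.mem_univ _, (Finset.mem_filter.1 hu).2⟩)
  · rcases v with x' | y'
    · refine le_trans ?_ (card_filter_common_le (fun x => EnergyRel M x y)
        (fun x₁ x₂ h1 h2 i hi => h1.left_ext hχ hM h2 hi) x')
      refine (Finset.card_le_card ?_).trans (Finset.card_image_le (f := Sum.inl))
      rintro (u | u) hu
      · exact Finset.mem_image_of_mem _ (Finset.mem_filter.2
          ⟨Finset.mem_univ _, (Finset.mem_filter.1 hu).2⟩)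
      · exact ((Finset.mem_filter.1 hu).2.2 : False).elim
    · rw [Finset.card_eq_zero.2]
      · exact Nat.zero_le _
      · refine Finset.filter_eq_empty_iff.2 ?_
        rintro (u | u) - ⟨h1, h2⟩
        · exact h2
        · exact h1

open Classical in
/-- Every `r`-tuple of distinct edges of the same matching gives an edge of the color energy
graph. -/
theorem sum_descFactorial_le_card [Fintype α] [Fintype β] [Fintype κ] (hr : 0 < r)
    (hχ : ∀ c, ∀ e ∈ M c, χ e.1 e.2 = c) (hM : ∀ c, IsMatchingSet (M c)) :
    ∑ c, (M c).card.descFactorial r ≤ (Finset.univ.filter fun p :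
      ((Fin r → α) ⊕ (Fin r → β)) × ((Fin r → α) ⊕ (Fin r → β)) => EnergyAdj M p.1 p.2).card := by
  have h1 : ∑ c, (M c).card.descFactorial r = Fintype.card (Σ c, (Fin r ↪ M c)) := by
    simp [Fintype.card_sigma, Fintype.card_embedding_eq]
  rw [h1, ← Finset.card_univ]
  refine Finset.card_le_card_of_injOn
    (fun g => (Sum.inl fun i => (g.2 i).1.1, Sum.inr fun i => (g.2 i).1.2)) ?_ ?_
  · rintro ⟨c, g⟩ -
    refine Finset.mem_coe.2 (Finset.mem_filter.2 ⟨Finset.mem_univ _, ?_, ?_, c, fun i => (g i).2⟩)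
    · intro i j hij
      exact g.injective (Subtype.ext (hM c _ (g i).2 _ (g j).2 (Or.inl hij)))
    · intro i j hij
      exact g.injective (Subtype.ext (hM c _ (g i).2 _ (g j).2 (Or.inr hij)))
  · rintro ⟨c, g⟩ - ⟨c', g'⟩ - heq
    simp only [Prod.mk.injEq, Sum.inl.injEq, Sum.inr.injEq] at heq
    have h2 : ∀ i, (g i).1 = (g' i).1 := fun i =>
      Prod.ext (congrFun heq.1 i) (congrFun heq.2 i)
    have hcc : c = c' := by
      rw [← hχ c _ (g ⟨0, hr⟩).2, ← hχ c' _ (g' ⟨0, hr⟩).2, h2]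
    subst hcc
    congr 1
    exact Function.Embedding.ext fun i => Subtype.ext (h2 i)

end Energy

end ErdosGyarfas

namespace ConflictFree

theorem IsTheta.reverse {V : Type*} {A R : V → V → Prop} (hA : ∀ u v, A u v → A v u)
    (hR : ∀ u v, R u v → R v u) {t k : ℕ} {a b : V} {P : Fin t → Fin (k + 1) → V}
    (h : IsTheta A R a b P) : IsTheta A R b a fun i j => P i j.rev where
  start i := by simpa using h.finish i
  finish i := by simpa using h.start i
  adj i j := by
    rw [Fin.rev_castSucc, Fin.rev_succ]
    exact hA _ _ (h.adj i j.rev)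
  within i u v huv hRuv := h.within i v.rev u.rev (Fin.rev_lt_rev.2 huv) (hR _ _ hRuv)
  cross i j hij u v h1 h2 h3 h4 := by
    refine h.cross i j hij u.rev v.rev ?_ ?_ ?_ ?_
    · rw [Fin.lt_def, Fin.val_rev]; rw [Fin.lt_def, Fin.val_last] at h2; simp; omega
    · rw [Fin.lt_def, Fin.val_rev]; rw [Fin.lt_def] at h1; simp at h1 ⊢; omega
    · rw [Fin.lt_def, Fin.val_rev]; rw [Fin.lt_def, Fin.val_last] at h4; simp; omega
    · rw [Fin.lt_def, Fin.val_rev]; rw [Fin.lt_def] at h3; simp at h3 ⊢; omega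

/-- Vertices of a conflict-free theta graph that conflict with each other are the same vertex. -/
theorem IsTheta.eq_of_conflict {V : Type*} {A R : V → V → Prop} (hR : ∀ u v, R u v → R v u)
    {t k : ℕ} {a b : V} {P : Fin t → Fin (k + 1) → V} (h : IsTheta A R a b P) {i j : Fin t}
    {u v : Fin (k + 1)} (huv : R (P i u) (P j v)) :
    u = v ∧ (i = j ∨ u = 0 ∨ u = Fin.last k) := by
  have same : ∀ l {u v : Fin (k + 1)}, R (P l u) (P l v) → u = v := by
    intro l u v h1
    rcases lt_trichotomy u v with h2 | h2 | h2
    · exact absurd h1 (h.within l u v h2)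
    · exact h2
    · exact absurd (hR _ _ h1) (h.within l v u h2)
  by_cases hij : i = j
  · subst hij
    exact ⟨same i huv, Or.inl rfl⟩
  by_cases hu0 : u = 0
  · refine ⟨same j ?_, Or.inr (Or.inl hu0)⟩
    rwa [hu0, h.start i, ← h.start j, ← hu0] at huv
  by_cases hul : u = Fin.last k
  · refine ⟨same j ?_, Or.inr (Or.inr hul)⟩
    rwa [hul, h.finish i, ← h.finish j, ← hul] at huv
  by_cases hv0 : v = 0
  · rw [hv0, h.start j, ← h.start i] at huv
    exact absurd (same i huv) hu0
  by_cases hvl : v = Fin.last k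
  · rw [hvl, h.finish j, ← h.finish i] at huv
    exact absurd (same i huv) hul
  exact absurd huv (h.cross i j hij u v (Fin.pos_of_ne_zero hu0) (Fin.lt_last_iff_ne_last.2 hul)
    (Fin.pos_of_ne_zero hv0) (Fin.lt_last_iff_ne_last.2 hvl))

end ConflictFree

/-! ### The lower bound on the number of colors -/

namespace ErdosGyarfas

open ConflictFree

section NoTheta

variable {α β κ : Type*} {r : ℕ}

/-- The sides of the vertices of a walk in the color energy graph alternate. -/
theorem isLeft_iff {M : κ → Finset (α × β)} {t k : ℕ} {a b : (Fin r → α) ⊕ (Fin r → β)}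
    {P : Fin t → Fin (k + 1) → (Fin r → α) ⊕ (Fin r → β)}
    (h : IsTheta (EnergyAdj M) Conflict a b P) (i : Fin t) (j : Fin (k + 1)) :
    (P i j).isLeft ↔ (a.isLeft ↔ Even (j : ℕ)) := by
  induction j using Fin.induction with
  | zero => simp [h.start i]
  | succ j ih =>
    have hadj := h.adj i j
    rw [Fin.val_succ, Nat.even_add_one, ← Fin.val_castSucc]
    rcases hu : P i j.castSucc with x | y <;> rcases hv : P i j.succ with x' | y' <;>
      rw [hu, hv] at hadj <;> rw [hu] at ih
    · exact hadj.elim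
    · simp only [Sum.isLeft_inl, true_iff, Sum.isLeft_inr] at ih ⊢
      tauto
    · simp only [Sum.isLeft_inl, true_iff, Sum.isLeft_inr] at ih ⊢
      tauto
    · exact hadj.elim

/-- A conflict-free theta graph in the color energy graph that starts on the left gives `r * s * t`
edges with at most `s * t` colors, on few enough vertices. -/
theorem FewRepeats.not_isTheta_inl [DecidableEq α] [DecidableEq β] [DecidableEq κ]
    {χ : α → β → κ} {p q : ℕ} (h : FewRepeats χ p q) {M : κ → Finset (α × β)}
    (hχ : ∀ c, ∀ e ∈ M c, χ e.1 e.2 = c) {t w : ℕ} (hw : 1 ≤ w)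
    (hp : p = r * (w * t + 1)) (hq : p ^ 2 + (2 * w + 1) * t < q + r * ((2 * w + 1) * t))
    {x₀ : Fin r → α} {b : (Fin r → α) ⊕ (Fin r → β)}
    {P : Fin t → Fin (2 * w + 1 + 1) → (Fin r → α) ⊕ (Fin r → β)} :
    ¬ IsTheta (EnergyAdj M) Conflict (.inl x₀) b P := by
  classical
  intro hP
  have hpar : ∀ i j, (P i j).isLeft ↔ Even (j : ℕ) := fun i j =>
    (isLeft_iff hP i j).trans (by simp)
  have hedge : ∀ (i : Fin t) (m : Fin (2 * w + 1)), ∃ (u v : Fin (2 * w + 1 + 1))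
      (x : Fin r → α) (y : Fin r → β) (c : κ), P i u = .inl x ∧ P i v = .inr y ∧
      ((u = m.castSucc ∧ v = m.succ) ∨ (u = m.succ ∧ v = m.castSucc)) ∧
      Function.Injective x ∧ ∀ l, (x l, y l) ∈ M c := by
    intro i m
    have hadj := hP.adj i m
    rcases hu : P i m.castSucc with x | y <;> rcases hv : P i m.succ with x' | y' <;>
      rw [hu, hv] at hadj
    · exact hadj.elim
    · obtain ⟨hx, -, c, hc⟩ := hadj
      exact ⟨_, _, x, y', c, hu, hv, Or.inl ⟨rfl, rfl⟩, hx, hc⟩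
    · obtain ⟨hx, -, c, hc⟩ := hadj
      exact ⟨_, _, x', y, c, hv, hu, Or.inr ⟨rfl, rfl⟩, hx, hc⟩
    · exact hadj.elim
  choose u v x y c hu hv huv hx hc using hedge
  have heven : ∀ i m, Even (u i m : ℕ) := fun i m => (hpar i _).1 (by rw [hu]; rfl)
  have hodd : ∀ i m, ¬ Even (v i m : ℕ) := fun i m he => by
    have := (hpar i _).2 he
    rw [hv] at this
    exact absurd this (by simp)
  set g : (Fin t × Fin (2 * w + 1)) × Fin r → α × β :=
    fun z => (x z.1.1 z.1.2 z.2, y z.1.1 z.1.2 z.2) with hg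
  have hginj : Function.Injective g := by
    rintro ⟨⟨i, m⟩, l⟩ ⟨⟨i', m'⟩, l'⟩ heq
    simp only [hg, Prod.mk.injEq] at heq
    have h1 : Conflict (P i (u i m)) (P i' (u i' m')) := by
      rw [hu, hu]; exact ⟨l, l', heq.1⟩
    have h2 : Conflict (P i (v i m)) (P i' (v i' m')) := by
      rw [hv, hv]; exact ⟨l, l', heq.2⟩
    obtain ⟨h3, h4⟩ := hP.eq_of_conflict Conflict.symm h1
    obtain ⟨h5, h6⟩ := hP.eq_of_conflict Conflict.symm h2
    have h7 := huv i m
    have h8 := huv i' m'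
    have hm : m = m' := by
      simp only [Fin.ext_iff, Fin.val_castSucc, Fin.val_succ] at h3 h5 h7 h8 ⊢
      omega
    subst hm
    have hi : i = i' := by
      by_contra hne
      have h4' := h4.resolve_left hne
      have h6' := h6.resolve_left hne
      simp only [Fin.ext_iff, Fin.val_castSucc, Fin.val_succ, Fin.val_zero, Fin.val_last]
        at h4' h6' h7
      omega
    subst hi
    rw [hx i m heq.1]
  have hcard : (Finset.univ.image g).card = r * ((2 * w + 1) * t) := by
    rw [Finset.card_image_of_injective _ hginj]
    simp only [Finset.card_univ, Fintype.card_prod, Fintype.card_fin]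
    ring
  have hcol : ((Finset.univ.image g).image fun e => χ e.1 e.2).card ≤ (2 * w + 1) * t := by
    refine (Finset.card_le_card (t := Finset.univ.image fun z : Fin t × Fin (2 * w + 1) =>
      c z.1 z.2) ?_).trans (Finset.card_image_le.trans ?_)
    · intro d hd
      obtain ⟨e, he, rfl⟩ := Finset.mem_image.1 hd
      obtain ⟨⟨⟨i, m⟩, l⟩, -, rfl⟩ := Finset.mem_image.1 he
      exact Finset.mem_image.2 ⟨(i, m), Finset.mem_univ _, (hχ _ _ (hc i m l)).symm⟩
    · simp only [Finset.card_univ, Fintype.card_prod, Fintype.card_fin]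
      rw [mul_comm]
  -- The two ends lie on different sides, so each side has `w * t + 1` vertices of the theta graph.
  have hverts : ∀ (a₀ : (Fin r → α) ⊕ (Fin r → β))
      (f : Fin t × Fin w → (Fin r → α) ⊕ (Fin r → β)),
      (insert a₀ (Finset.univ.image f)).card ≤ w * t + 1 := by
    intro a₀ f
    refine (Finset.card_insert_le _ _).trans (Nat.add_le_add_right
      (Finset.card_image_le.trans ?_) 1)
    simp only [Finset.card_univ, Fintype.card_prod, Fintype.card_fin]
    rw [mul_comm]
  have hrows : ((Finset.univ.image g).image Prod.fst).card ≤ p := by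
    refine (Finset.card_le_card (t := (insert (Sum.inl x₀) (Finset.univ.image
      fun z : Fin t × Fin w => P z.1 ⟨2 * z.2 + 2, by omega⟩)).biUnion
      (Sum.elim (fun x => Finset.univ.image x) fun _ => ∅)) ?_).trans
      ((Finset.card_biUnion_le_card_mul _ _ r ?_).trans ?_)
    · intro d hd
      obtain ⟨e, he, rfl⟩ := Finset.mem_image.1 hd
      obtain ⟨⟨⟨i, m⟩, l⟩, -, rfl⟩ := Finset.mem_image.1 he
      refine Finset.mem_biUnion.2 ⟨P i (u i m), ?_, ?_⟩
      · obtain ⟨j, hj⟩ := heven i m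
        rcases Nat.eq_zero_or_pos j with hj0 | hj0
        · have : u i m = 0 := Fin.ext (by rw [hj, hj0]; rfl)
          rw [this, hP.start i]
          exact Finset.mem_insert_self _ _
        · refine Finset.mem_insert_of_mem (Finset.mem_image.2
            ⟨(i, ⟨j - 1, by omega⟩), Finset.mem_univ _, ?_⟩)
          congr 1
          exact Fin.ext (by simp only [hj]; omega)
      · rw [hu]
        exact Finset.mem_image_of_mem _ (Finset.mem_univ l)
    · rintro (x' | y') -
      · exact Finset.card_image_le.trans (by simp)
      · simp
    · rw [hp, mul_comm]
      exact Nat.mul_le_mul_left _ (hverts _ _)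
  have hcols : ((Finset.univ.image g).image Prod.snd).card ≤ p := by
    refine (Finset.card_le_card (t := (insert b (Finset.univ.image
      fun z : Fin t × Fin w => P z.1 ⟨2 * z.2 + 1, by omega⟩)).biUnion
      (Sum.elim (fun _ => ∅) fun y => Finset.univ.image y)) ?_).trans
      ((Finset.card_biUnion_le_card_mul _ _ r ?_).trans ?_)
    · intro d hd
      obtain ⟨e, he, rfl⟩ := Finset.mem_image.1 hd
      obtain ⟨⟨⟨i, m⟩, l⟩, -, rfl⟩ := Finset.mem_image.1 he
      refine Finset.mem_biUnion.2 ⟨P i (v i m), ?_, ?_⟩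
      · obtain ⟨j, hj⟩ := Nat.not_even_iff_odd.1 (hodd i m)
        by_cases hjw : j = w
        · have : v i m = Fin.last _ := Fin.ext (by rw [hj, hjw]; rfl)
          rw [this, hP.finish i]
          exact Finset.mem_insert_self _ _
        · refine Finset.mem_insert_of_mem (Finset.mem_image.2
            ⟨(i, ⟨j, by omega⟩), Finset.mem_univ _, ?_⟩)
          congr 1
          exact Fin.ext hj.symm
      · rw [hv]
        exact Finset.mem_image_of_mem _ (Finset.mem_univ l)
    · rintro (x' | y') -
      · simp
      · exact Finset.card_image_le.trans (by simp)
    · rw [hp, mul_comm]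
      exact Nat.mul_le_mul_left _ (hverts _ _)
  have := h _ hrows hcols
  rw [hcard] at this
  omega

theorem FewRepeats.not_isTheta [DecidableEq α] [DecidableEq β] [DecidableEq κ]
    {χ : α → β → κ} {p q : ℕ} (h : FewRepeats χ p q) {M : κ → Finset (α × β)}
    (hχ : ∀ c, ∀ e ∈ M c, χ e.1 e.2 = c) {t w : ℕ} (ht : 0 < t) (hw : 1 ≤ w)
    (hp : p = r * (w * t + 1)) (hq : p ^ 2 + (2 * w + 1) * t < q + r * ((2 * w + 1) * t))
    {a b : (Fin r → α) ⊕ (Fin r → β)}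
    {P : Fin t → Fin (2 * w + 1 + 1) → (Fin r → α) ⊕ (Fin r → β)} :
    ¬ IsTheta (EnergyAdj M) Conflict a b P := by
  intro hP
  have main : ∀ {a b : (Fin r → α) ⊕ (Fin r → β)}
      {P : Fin t → Fin (2 * w + 1 + 1) → (Fin r → α) ⊕ (Fin r → β)},
      IsTheta (EnergyAdj M) Conflict a b P → a.isLeft → False := by
    rintro (x | y) b P hP hleft
    · exact h.not_isTheta_inl hχ hw hp hq hP
    · simp at hleft
  by_cases ha : a.isLeft
  · exact main hP ha
  · refine main (hP.reverse (EnergyAdj.symm M) Conflict.symm) ?_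
    have h1 := isLeft_iff hP ⟨0, ht⟩ (Fin.last _)
    rw [hP.finish, Fin.val_last] at h1
    refine h1.2 ⟨fun h => absurd h ha, fun h => absurd h ?_⟩
    simp

end NoTheta

theorem sq_le_encard_edgeSet (p : ℕ) :
    ((p ^ 2 : ℕ) : ℕ∞) ≤ (completeBipartiteGraph (Fin p) (Fin p)).edgeSet.encard := by
  have hinj : Function.Injective fun e : Fin p × Fin p =>
      (s(Sum.inl e.1, Sum.inr e.2) : Sym2 (Fin p ⊕ Fin p)) := by
    rintro ⟨a, b⟩ ⟨a', b'⟩ h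
    simpa using h
  have hsub : (Set.range fun e : Fin p × Fin p =>
      (s(Sum.inl e.1, Sum.inr e.2) : Sym2 (Fin p ⊕ Fin p))) ⊆
      (completeBipartiteGraph (Fin p) (Fin p)).edgeSet := by
    rintro _ ⟨e, rfl⟩
    simp
  refine le_trans (le_of_eq ?_) (hinj.encard_range.trans (Set.encard_le_encard hsub))
  simp [sq]

/-- The lower bound on the number `k` of colors, before roots are taken. -/
theorem exists_pow_le (r t w p q : ℕ) (hr : 2 ≤ r) (ht : 2 ≤ t) (hw : 1 ≤ w)
    (hp : p = r * (w * t + 1)) (hq1 : p ^ 2 + 2 < 2 * p + q)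
    (hq2 : p ^ 2 + (2 * w + 1) * t < q + r * ((2 * w + 1) * t)) :
    ∃ B : ℕ, 1 ≤ B ∧ ∀ n k : ℕ, 1 ≤ n → ∀ χ : Fin n → Fin n → Fin k, FewRepeats χ p q →
      n ^ (r * (2 * w)) ≤ (B * k) ^ ((r - 1) * (2 * w + 1)) := by
  have hp2 : 2 ≤ p := by
    rw [hp]
    calc 2 ≤ r * 1 := by omega
      _ ≤ r * (w * t + 1) := Nat.mul_le_mul_left _ (by omega)
  set Θ := thetaConst t (2 * w + 1) (r ^ 2) with hΘ
  set B₁ := (32 * p) ^ (r * (2 * w + 1)) * (Θ ^ (2 * w + 1) * 2 ^ (2 * w + 2)) with hB₁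
  have hΘ1 : 1 ≤ Θ := by
    have : 0 < r := by omega
    have : 0 < t := by omega
    rw [hΘ]; unfold thetaConst
    exact Nat.succ_le_of_lt (by positivity)
  have hB₁1 : 1 ≤ B₁ := Nat.succ_le_of_lt (by positivity)
  have he : 1 ≤ (r - 1) * (2 * w + 1) := Nat.succ_le_of_lt (Nat.mul_pos (by omega) (by omega))
  refine ⟨B₁ * (32 * p * r), Nat.succ_le_of_lt (Nat.mul_pos hB₁1
    (Nat.mul_pos (by omega) (by omega))), fun n k hn χ hχ => ?_⟩
  obtain ⟨M, hM1, hM2, hM3⟩ := hχ.exists_matchings hp2 hq1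
  set m := ∑ c, (M c).card with hm
  -- If the matchings have fewer than `2 * r` edges on average, then `k` is at least of
  -- order `n ^ 2`.
  rcases lt_or_ge m (2 * r * k) with hmk | hmk
  · have h1 : n ^ 2 ≤ B₁ * (32 * p * r) * k := by
      calc n ^ 2 ≤ 16 * p * m := hM3
        _ ≤ 16 * p * (2 * r * k) := Nat.mul_le_mul_left _ hmk.le
        _ = 1 * (32 * p * r * k) := by ring
        _ ≤ B₁ * (32 * p * r * k) := Nat.mul_le_mul_right _ hB₁1
        _ = _ := by ring
    calc n ^ (r * (2 * w)) ≤ n ^ (2 * ((r - 1) * (2 * w + 1))) := by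
          refine Nat.pow_le_pow_right hn ?_
          obtain ⟨r', rfl⟩ : ∃ r', r = r' + 2 := ⟨r - 2, by omega⟩
          rw [show r' + 2 - 1 = r' + 1 by omega]
          nlinarith [Nat.zero_le (r' * w)]
      _ = (n ^ 2) ^ ((r - 1) * (2 * w + 1)) := pow_mul _ _ _
      _ ≤ _ := Nat.pow_le_pow_left h1 _
  classical
  set E := (Finset.univ.filter fun e : ((Fin r → Fin n) ⊕ (Fin r → Fin n)) ×
    ((Fin r → Fin n) ⊕ (Fin r → Fin n)) => EnergyAdj M e.1 e.2).card with hE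
  have hV : Fintype.card ((Fin r → Fin n) ⊕ (Fin r → Fin n)) = 2 * n ^ r := by
    simp; ring
  have hElt : E ^ (2 * w + 1) < Θ ^ (2 * w + 1) * (2 * n ^ r) ^ (2 * w + 1 + 1) := by
    by_contra! hcon
    rw [← hV] at hcon
    obtain ⟨a, b, P, hP⟩ := exists_isTheta (A := EnergyAdj M) (R := Conflict) (EnergyAdj.symm M)
      Conflict.symm (K := r ^ 2) (k := 2 * w + 1) (t := t) (by positivity)
      (fun y v => card_conflict_le hM1 hM2 y v) (by omega) ht (by rw [hV]; positivity) hcon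
    exact hχ.not_isTheta hM1 (by omega) hw hp hq2 hP
  -- Jensen's inequality for the numbers of `r`-tuples of edges in the matchings.
  have hEge : (m - r * k) ^ r ≤ k ^ (r - 1) * E := by
    have h1 : m - r * k ≤ ∑ c, ((M c).card - r) := by
      have h2 : m ≤ ∑ c, ((M c).card - r) + ∑ _c : Fin k, r := by
        rw [hm, ← Finset.sum_add_distrib]
        exact Finset.sum_le_sum fun c _ => by omega
      simp only [Finset.sum_const, Finset.card_univ, Fintype.card_fin, smul_eq_mul] at h2
      rw [mul_comm k r] at h2
      omega
    have h3 := pow_sum_le_card_mul_sum_pow (s := (Finset.univ : Finset (Fin k)))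
      (f := fun c => (M c).card - r) (fun _ _ => Nat.zero_le _) (r - 1)
    rw [Nat.sub_add_cancel (by omega : 1 ≤ r), Finset.card_univ, Fintype.card_fin] at h3
    refine (Nat.pow_le_pow_left h1 r).trans (h3.trans (Nat.mul_le_mul_left _ ?_))
    refine le_trans (Finset.sum_le_sum fun c _ => ?_)
      (sum_descFactorial_le_card (r := r) (by omega) hM1 hM2)
    exact (Nat.pow_le_pow_left (by omega) r).trans (Nat.pow_sub_le_descFactorial _ _)
  have h1 : n ^ 2 ≤ 32 * p * (m - r * k) := by
    have h2 : m ≤ 2 * (m - r * k) := by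
      have : 2 * r * k = 2 * (r * k) := by ring
      omega
    calc n ^ 2 ≤ 16 * p * m := hM3
      _ ≤ 16 * p * (2 * (m - r * k)) := Nat.mul_le_mul_left _ h2
      _ = _ := by ring
  have h2 : n ^ (r * (2 * w)) * n ^ (r * (2 * w + 2)) ≤
      B₁ * k ^ ((r - 1) * (2 * w + 1)) * n ^ (r * (2 * w + 2)) := by
    calc n ^ (r * (2 * w)) * n ^ (r * (2 * w + 2)) = (n ^ 2) ^ (r * (2 * w + 1)) := by
          rw [← pow_add, ← pow_mul]; congr 1; ring
      _ ≤ (32 * p * (m - r * k)) ^ (r * (2 * w + 1)) := Nat.pow_le_pow_left h1 _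
      _ = (32 * p) ^ (r * (2 * w + 1)) * ((m - r * k) ^ r) ^ (2 * w + 1) := by
          rw [mul_pow, ← pow_mul (m - r * k)]
      _ ≤ (32 * p) ^ (r * (2 * w + 1)) * (k ^ (r - 1) * E) ^ (2 * w + 1) :=
          Nat.mul_le_mul_left _ (Nat.pow_le_pow_left hEge _)
      _ = (32 * p) ^ (r * (2 * w + 1)) * (k ^ ((r - 1) * (2 * w + 1)) * E ^ (2 * w + 1)) := by
          rw [mul_pow (k ^ (r - 1)), ← pow_mul k]
      _ ≤ (32 * p) ^ (r * (2 * w + 1)) * (k ^ ((r - 1) * (2 * w + 1)) *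
            (Θ ^ (2 * w + 1) * (2 * n ^ r) ^ (2 * w + 1 + 1))) :=
          Nat.mul_le_mul_left _ (Nat.mul_le_mul_left _ hElt.le)
      _ = _ := by
          rw [mul_pow 2 (n ^ r), ← pow_mul n, hB₁]
          ring
  have h3 := Nat.le_of_mul_le_mul_right h2 (by positivity)
  calc n ^ (r * (2 * w)) ≤ B₁ * k ^ ((r - 1) * (2 * w + 1)) := h3
    _ ≤ (B₁ * (32 * p * r)) ^ ((r - 1) * (2 * w + 1)) * k ^ ((r - 1) * (2 * w + 1)) := by
        refine Nat.mul_le_mul_right _ ?_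
        have h4 : B₁ ≤ B₁ * (32 * p * r) :=
          Nat.le_mul_of_pos_right _ (Nat.mul_pos (by omega) (by omega))
        exact h4.trans (Nat.le_self_pow (by omega) _)
    _ = _ := (mul_pow _ _ _).symm

end ErdosGyarfas

theorem mainTheorem2 (t r s p q : ℕ) (ht : 2 ≤ t) (hr : 3 ≤ r) (hs : 2 * r - 1 ≤ s) (hodd : Odd s)
    (hp : (p : ℝ) = r * ((s - 1) * t / 2 + 1))
    (hq : (q : ℤ) = p ^ 2 - (r - 1) * s * t + 2) :
    (fun n : ℕ => (n : ℝ) ^ ((r : ℝ) / (r - 1) * (1 - 1 / s))) =O[atTop]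
      fun n : ℕ => (ErdosGyarfas.colorNumber (completeBipartiteGraph (Fin n) (Fin n))
        (completeBipartiteGraph (Fin p) (Fin p)) q : ℝ) := by
  obtain ⟨w, rfl⟩ := hodd
  have hw : r ≤ w + 1 := by omega
  have hp' : p = r * (w * t + 1) := by
    have h1 : (p : ℝ) = ((r * (w * t + 1) : ℕ) : ℝ) := by
      rw [hp]; push_cast; ring
    exact_mod_cast h1
  have hpZ : (p : ℤ) = r * (w * t + 1) := by exact_mod_cast hp'
  push_cast at hq
  have hq2 : p ^ 2 + (2 * w + 1) * t < q + r * ((2 * w + 1) * t) := by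
    zify
    rw [hq]
    linarith [show ((r : ℤ) - 1) * (2 * w + 1) * t =
      r * ((2 * w + 1) * t) - (2 * w + 1) * t by ring]
  have hq1 : p ^ 2 + 2 < 2 * p + q := by
    zify
    rw [hq]
    have h1 : (0 : ℤ) ≤ (2 * w + 1 - r) * t :=
      mul_nonneg (by zify at hw hr; linarith) (by positivity)
    have h2 : (0 : ℤ) < r := by exact_mod_cast (by omega : 0 < r)
    rw [hpZ]
    nlinarith
  have hqle : q ≤ p ^ 2 := by
    zify
    rw [hq]
    have h1 : (2 : ℤ) ≤ (r - 1) * (2 * w + 1) * t := by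
      have h2 : (2 : ℤ) ≤ r - 1 := by zify at hr; linarith
      have h3 : (1 : ℤ) ≤ (2 * w + 1) * t := by
        have : (1 : ℤ) ≤ t := by exact_mod_cast (by omega : 1 ≤ t)
        nlinarith
      nlinarith
    linarith
  obtain ⟨B, hB, hmain⟩ := ErdosGyarfas.exists_pow_le r t w p q (by omega) ht (by omega) hp' hq1 hq2
  refine IsBigO.of_bound B ?_
  filter_upwards [eventually_ge_atTop p, eventually_ge_atTop 1] with n hpn hn
  obtain ⟨C, hC⟩ := ErdosGyarfas.colorNumber_spec (completeBipartiteGraph (Fin n) (Fin n))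
    (completeBipartiteGraph (Fin p) (Fin p)) q
    ((Nat.cast_le.2 hqle).trans (ErdosGyarfas.sq_le_encard_edgeSet p))
  set k := ErdosGyarfas.colorNumber (completeBipartiteGraph (Fin n) (Fin n))
    (completeBipartiteGraph (Fin p) (Fin p)) q
  have h1 := hmain n k hn _ (ErdosGyarfas.fewRepeats_of_isHQColoring hpn hC)
  have h2 : (n : ℝ) ^ (r * (2 * w)) ≤ (B * k : ℝ) ^ ((r - 1) * (2 * w + 1)) := by
    exact_mod_cast h1
  have he : (r - 1) * (2 * w + 1) ≠ 0 := (Nat.mul_pos (by omega) (by omega)).ne'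
  rw [Real.norm_of_nonneg (by positivity), Real.norm_of_nonneg (by positivity)]
  have hBk : (0 : ℝ) ≤ B * k := by positivity
  calc (n : ℝ) ^ ((r : ℝ) / (r - 1) * (1 - 1 / (2 * w + 1 : ℕ)))
      = ((n : ℝ) ^ (r * (2 * w))) ^ ((((r - 1) * (2 * w + 1) : ℕ) : ℝ)⁻¹) := by
        rw [← Real.rpow_natCast, ← Real.rpow_mul (by positivity)]
        congr 1
        have h3 : (r : ℝ) - 1 ≠ 0 := by
          have : (3 : ℝ) ≤ r := by exact_mod_cast hr
          linarith
        push_cast [Nat.cast_sub (show 1 ≤ r by omega)]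
        field_simp
        ring
    _ ≤ ((B * k : ℝ) ^ ((r - 1) * (2 * w + 1))) ^ ((((r - 1) * (2 * w + 1) : ℕ) : ℝ)⁻¹) :=
        Real.rpow_le_rpow (by positivity) h2 (by positivity)
    _ = B * k := Real.pow_rpow_inv_natCast hBk he
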